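/- Let $k$ be an algebraically closed field of characteristic zero and let $\mathcal{C}$ be a fusion category over $k$: a $k$-linear abelian rigid monoidal category with $k$-bilinear tensor product, in which every object is a finite direct sum of simple objects, with finitely many isomorphism classes of simple objects, finite-dimensional Hom spaces and simple unit object $\mathbf 1$. Let $G$ be a finite group acting on $\mathcal{C}$ by tensor autoequivalences: $k$-linear monoidal functors $\rho^g$ ($g\in G$), with coherent monoidal natural isomorphisms $\rho_2^{g,h}:\rho^g\rho^h\to\rho^{gh}$ and $\rho_0:\mathrm{id}\to\rho^e$. The equivariantization $\mathcal{C}^G$ has as objects the pairs $(X,\mu)$ with isomorphisms $\mu^g:\rho^gX\to X$ such that $\mu^g\rho^g(\mu^h)=\mu^{gh}(\rho_2^{g,h})_X$ and $\mu^e(\rho_0)_X=\mathrm{id}_X$; its tensor product is $(X,\mu)\otimes(X',\mu')=(X\otimes X',\ (\mu^g\otimes\mu'^g)\circ(\rho^g(X\otimes X')\cong\rho^gX\otimes\rho^gX'))$. Let $Y$ be a simple object of $\mathcal{C}$ and $G_Y=\{g\in G:\rho^g(Y)\simeq Y\}$. Choose isomorphisms $c^g:\rho^g(Y)\to Y$ for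 $g\in G_Y$, and let $\alpha:G_Y\times G_Y\to k^*$ be their factor set, given by $\alpha(g,h)^{-1}\mathrm{id}_Y=c^g\,\rho^g(c^h)\,(\rho_2^{g,h})_Y^{-1}(c^{gh})^{-1}$. Let $\pi:G_Y\to GL(V)$ be an irreducible finite-dimensional projective representation with $\pi(g)\pi(h)=\alpha(g,h)\pi(gh)$. For a set $R$ of representatives of the left cosets of $G_Y$ in $G$, let $$S_{Y,\pi}=S^{c}_{Y,\pi}=\Bigl(\bigoplus_{t\in R}\rho^t(V\otimes Y),\ \mu\Bigr)\in\mathcal{C}^G,$$ where the component of $\mu^g$ on $\rho^g\rho^t(V\otimes Y)$ is $\rho^s(\pi(h)\otimes c^h)(\rho_2^{s,h})^{-1}\rho_2^{g,t}$, with $gt=sh$, $s\in R$, $h\in G_Y$. The same notation is used with $Y$ replaced by the (simple) dual object $Y^*$, and any set $R'$ of representatives. Let $\pi^*$ be the projective representation $\pi^*(h)(f)=f\circ\pi(h)^{-1}$ of $G_Y$ on $V^*$, with factor set $\alpha^{-1}$. **Proposition 3.12.** The object $Y^*$ is simple, $G_{Y^*}=G_Y$, and $\pi^*$ is irreducible.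 Moreover, for all $R$ and $R'$, the following hold. 1. Let $(c^*)^g:\rho^g(Y^*)\cong\rho^g(Y)^*\to Y^*$ be the isomorphisms induced by $c^g$ by duality, that is, $(c^*)^g$ is the composite of the canonical isomorphism with the inverse of the transpose of $c^g$. Their factor set is $\alpha^{-1}$, and $S^{c^*}_{Y^*,\pi^*}$ is a dual object of $S^{c}_{Y,\pi}$ in $\mathcal{C}^G$: $$S_{Y,\pi}^*\simeq S_{Y^*,\pi^*}.$$ 2. For an arbitrary choice of isomorphisms $c'^g:\rho^g(Y^*)\to Y^*$ ($g\in G_Y$), with factor set $\alpha'$, there is a projective representation $\sigma$ of $G_Y$ on $V^*$ with factor set $\alpha'$, projectively equivalent to $\pi^*$, such that $S^{c'}_{Y^*,\sigma}$ is a dual object of $S^{c}_{Y,\pi}$. (Two projective representations $\pi,\pi'$ are projectively equivalent if there are a linear isomorphism $\phi$ and a map $f:G_Y\to k^*$ with $\phi\,\pi(g)=f(g)\,\pi'(g)\,\phi$ for all $g$. A dual object of $S$ is an object $S^*$ with morphisms $S^*\otimes S\to\mathbf 1$ and $\mathbf 1\to S\otimes S^*$ satisfying the two triangle identities; it is unique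 up to isomorphism.) -/

import Mathlib

open CategoryTheory CategoryTheory.Limits CategoryTheory.MonoidalCategory

universe u v

namespace Equivariantization

instance hasFiniteBiproducts_of_abelian {C : Type u} [Category.{v} C] [Abelian C] :
    HasFiniteBiproducts C :=
  Abelian.hasFiniteBiproducts

/-- The conditions (beyond the ambient `k`-linear abelian rigid monoidal structure) making `C` a
fusion category over `k`: finite-dimensional Hom spaces, every object is a finite direct sum of
simple objects, finitely many simple objects up to isomorphism, simple unit object. -/
class IsFusion (k : Type*) [Field k] (C : Type u) [Category.{v} C] [Abelian C] [Linear k C]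
    [MonoidalCategory C] [MonoidalPreadditive C] [MonoidalLinear k C] [RigidCategory C] :
    Prop where
  finiteDimensional_hom : ∀ X Y : C, FiniteDimensional k (X ⟶ Y)
  semisimple : ∀ X : C, ∃ (n : ℕ) (S : Fin n → C),
    (∀ i, Simple (S i)) ∧ Nonempty (X ≅ ⨁ S)
  finite_simples : ∃ (n : ℕ) (S : Fin n → C), ∀ X : C, Simple X → ∃ i, Nonempty (X ≅ S i)
  simple_unit : Simple (𝟙_ C)

/-- An action of the group `G` on the `k`-linear category `C` by `k`-linear autoequivalences:
functors `F g = ρ^g`, coherent isomorphisms `ρ₂^{g,h} : ρ^g ρ^h ≅ ρ^{gh}` and `ρ₀ : id ≅ ρ^e`.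
The isomorphism `ρ₂^{g,h}` is written `comp e`, where `e : g * h = l` names the product; this
only avoids transporting along equalities of group elements. (Mathlib composes functors and
morphisms from left to right, so `F h ⋙ F g` is `ρ^g ρ^h`.) -/
structure LinearAction (k : Type*) [Field k] (G : Type*) [Group G] (C : Type u) [Category.{v} C]
    [Preadditive C] [Linear k C] where
  F : G → C ⥤ C
  additive : ∀ g, (F g).Additive
  linear : ∀ g, (F g).Linear k
  comp : ∀ {g h l : G}, g * h = l → (F h ⋙ F g ≅ F l)
  unit : 𝟭 C ≅ F 1
  assoc : ∀ {a b c ab bc abc : G} (h₁ : a * b = ab) (h₂ : b * c = bc) (h₃ : ab * c = abc)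
    (h₄ : a * bc = abc) (X : C),
    (comp h₁).hom.app ((F c).obj X) ≫ (comp h₃).hom.app X =
      (F a).map ((comp h₂).hom.app X) ≫ (comp h₄).hom.app X
  unit_right : ∀ (a : G) (X : C),
    (F a).map (unit.hom.app X) ≫ (comp (mul_one a)).hom.app X = 𝟙 ((F a).obj X)
  unit_left : ∀ (a : G) (X : C),
    unit.hom.app ((F a).obj X) ≫ (comp (one_mul a)).hom.app X = 𝟙 ((F a).obj X)

attribute [instance] LinearAction.additive LinearAction.linear

/-- An action of `G` on `C` by tensor autoequivalences: the functors `ρ^g` are (strong) monoidal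
and the isomorphisms `ρ₂^{g,h}` and `ρ₀` are isomorphisms of monoidal functors. -/
structure TensorAction (k : Type*) [Field k] (G : Type*) [Group G] (C : Type u) [Category.{v} C]
    [Preadditive C] [Linear k C] [MonoidalCategory C] extends LinearAction k G C where
  [monoidal : ∀ g, (F g).Monoidal]
  comp_isMonoidal : ∀ {g h l : G} (e : g * h = l), NatTrans.IsMonoidal (comp e).hom
  unit_isMonoidal : NatTrans.IsMonoidal unit.hom

attribute [instance] TensorAction.monoidal TensorAction.comp_isMonoidal
  TensorAction.unit_isMonoidal

section Linear

variable {k : Type*} [Field k] {G : Type*} [Group G] {C : Type u} [Category.{v} C]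

section Basic

variable [Preadditive C] [Linear k C]

/-- The inertia subgroup `G_Y = {g ∈ G | ρ^g(Y) ≅ Y}`. -/
def LinearAction.inertia (A : LinearAction k G C) (Y : C) : Subgroup G where
  carrier := {g | Nonempty ((A.F g).obj Y ≅ Y)}
  one_mem' := ⟨(A.unit.app Y).symm⟩
  mul_mem' := by
    rintro g h ⟨i⟩ ⟨j⟩
    exact ⟨((A.comp (rfl : g * h = g * h)).app Y).symm ≪≫ (A.F g).mapIso j ≪≫ i⟩
  inv_mem' := by
    rintro g ⟨i⟩
    exact ⟨(A.F g⁻¹).mapIso i.symm ≪≫ (A.comp (inv_mul_cancel g)).app Y ≪≫ (A.unit.app Y).symm⟩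

/-- The restriction of an action of `G` to a subgroup `H`. -/
def LinearAction.restrict (A : LinearAction k G C) (H : Subgroup G) : LinearAction k H C where
  F h := A.F h
  additive h := A.additive h
  linear h := A.linear h
  comp e := A.comp (congrArg Subtype.val e)
  unit := A.unit
  assoc h₁ h₂ h₃ h₄ X := A.assoc (congrArg Subtype.val h₁) (congrArg Subtype.val h₂)
    (congrArg Subtype.val h₃) (congrArg Subtype.val h₄) X
  unit_right a X := A.unit_right a X
  unit_left a X := A.unit_left a X

/-- Objects of the equivariantization `C^G`: pairs `(X, μ)`, where `μ^g : ρ^g X ⟶ X` satisfies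
`μ^g ρ^g(μ^h) = μ^{gh} ρ₂^{g,h}` and `μ^e ρ₀ = id`. That all `μ^g` are isomorphisms follows,
see `EquivObj.isIso_μ`. -/
structure EquivObj (A : LinearAction k G C) where
  X : C
  μ : ∀ g, (A.F g).obj X ⟶ X
  comp : ∀ {g h l : G} (e : g * h = l),
    (A.F g).map (μ h) ≫ μ g = (A.comp e).hom.app X ≫ μ l
  unit : A.unit.hom.app X ≫ μ 1 = 𝟙 X

theorem EquivObj.isIso_μ {A : LinearAction k G C} (M : EquivObj A) (g : G) : IsIso (M.μ g) := by
  have h1 : IsIso (M.μ 1) := by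
    have : M.μ 1 = inv (A.unit.hom.app M.X) := (IsIso.inv_eq_of_hom_inv_id M.unit).symm
    rw [this]; infer_instance
  have key : ∀ a : G, IsIso ((A.F a).map (M.μ a⁻¹) ≫ M.μ a) := fun a => by
    rw [M.comp (mul_inv_cancel a)]; infer_instance
  have hepi : IsSplitEpi (M.μ g⁻¹) :=
    IsSplitEpi.mk' ⟨inv ((A.F g⁻¹).map (M.μ g⁻¹⁻¹) ≫ M.μ g⁻¹) ≫ (A.F g⁻¹).map (M.μ g⁻¹⁻¹), by simp⟩
  have hmono : IsSplitMono ((A.F g).map (M.μ g⁻¹)) :=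
    IsSplitMono.mk' ⟨M.μ g ≫ inv ((A.F g).map (M.μ g⁻¹) ≫ M.μ g), by
      rw [← Category.assoc, IsIso.hom_inv_id]⟩
  have h2 : IsIso ((A.F g).map (M.μ g⁻¹)) := isIso_of_mono_of_isSplitEpi _
  have := key g
  exact IsIso.of_isIso_comp_left ((A.F g).map (M.μ g⁻¹)) (M.μ g)

/-- Morphisms `(X, μ) ⟶ (X', μ')` of `C^G`: morphisms `f` of `C` with `f μ^g = μ'^g ρ^g(f)`. -/
@[ext]
structure EquivObj.Hom {A : LinearAction k G C} (M N : EquivObj A) where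
  f : M.X ⟶ N.X
  comm : ∀ g, M.μ g ≫ f = (A.F g).map f ≫ N.μ g

/-- The equivariantization `C^G`. -/
instance (A : LinearAction k G C) : Category (EquivObj A) where
  Hom M N := EquivObj.Hom M N
  id M := ⟨𝟙 M.X, fun g => by simp⟩
  comp p q := ⟨p.f ≫ q.f, fun g => by
    rw [← Category.assoc, p.comm, Category.assoc, q.comm, Functor.map_comp, Category.assoc]⟩

@[ext]
theorem EquivObj.hom_ext {A : LinearAction k G C} {M N : EquivObj A} {p q : M ⟶ N}
    (h : p.f = q.f) : p = q := EquivObj.Hom.ext h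

/-- The forgetful functor `C^G ⥤ C`. -/
@[simps]
def EquivObj.forget (A : LinearAction k G C) : EquivObj A ⥤ C where
  obj M := M.X
  map p := p.f

instance (A : LinearAction k G C) : (EquivObj.forget A).Faithful where
  map_injective h := EquivObj.hom_ext h

end Basic

/-! ### Projective representations -/

/-- A projective representation of `H` on `V` with factor set `α`:
`π(g) π(h) = α(g,h) π(gh)`. If `α` is normalized then automatically `π(e) = id`. -/
structure ProjRep {H : Type*} [Group H] (α : H → H → kˣ) (V : Type*) [AddCommGroup V]
    [Module k V] where
  toFun : H → (V ≃ₗ[k] V)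
  map_mul : ∀ g h v, toFun g (toFun h v) = (α g h : k) • toFun (g * h) v

namespace ProjRep

variable {H : Type*} [Group H] {α β : H → H → kˣ} {V W : Type*} [AddCommGroup V] [Module k V]
  [AddCommGroup W] [Module k W]

theorem map_one (π : ProjRep α V) (v : V) : π.toFun 1 v = (α 1 1 : k) • v := by
  apply (π.toFun 1).injective
  rw [π.map_mul, mul_one, map_smul]

/-- `π` is irreducible: `V ≠ 0`, and `0` and `V` are the only invariant subspaces. -/
def Irreducible (π : ProjRep α V) : Prop :=
  Nontrivial V ∧ ∀ U : Submodule k V, (∀ h, ∀ v ∈ U, π.toFun h v ∈ U) → U = ⊥ ∨ U = ⊤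

/-- Projective equivalence: a linear isomorphism `φ` and a map `f : H → k^*` with
`φ π(g) = f(g) π'(g) φ`. -/
def ProjEquiv (π : ProjRep α V) (π' : ProjRep β W) : Prop :=
  ∃ (φ : V ≃ₗ[k] W) (f : H → kˣ), ∀ g v, φ (π.toFun g v) = (f g : k) • π'.toFun g (φ v)

/-- The dual projective representation on `V^*`, `π^*(h)(f) = f ∘ π(h)⁻¹`, with factor set
`α⁻¹`. -/
def dual (π : ProjRep α V) : ProjRep (fun g h => (α g h)⁻¹) (Module.Dual k V) where
  toFun h := (π.toFun h).symm.dualMap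
  map_mul g h f := by
    ext v
    obtain ⟨w, rfl⟩ := (π.toFun (g * h)).surjective v
    have key : (π.toFun h).symm ((π.toFun g).symm (π.toFun (g * h) w))
        = (((α g h)⁻¹ : kˣ) : k) • w := by
      rw [LinearEquiv.symm_apply_eq, LinearEquiv.symm_apply_eq, map_smul, map_smul, π.map_mul,
        smul_smul]
      simp
    simp [LinearEquiv.dualMap_apply, key]

end ProjRep

section Clifford

variable [Abelian C] [Linear k C]

/-! ### Additive functors and finite direct sums -/

theorem map_biproduct_hom_ext {J : Type*} [Finite J] (F : C ⥤ C) [F.Additive] {f : J → C} {Z : C}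
    {p q : F.obj (⨁ f) ⟶ Z}
    (h : ∀ j, F.map (biproduct.ι f j) ≫ p = F.map (biproduct.ι f j) ≫ q) : p = q := by
  classical
  have := Fintype.ofFinite J
  have key : ∀ r : F.obj (⨁ f) ⟶ Z,
      r = ∑ j, F.map (biproduct.π f j) ≫ F.map (biproduct.ι f j) ≫ r := fun r => by
    have h1 : F.map (∑ j, biproduct.π f j ≫ biproduct.ι f j) ≫ r = r := by
      have h2 : ∑ j, biproduct.π f j ≫ biproduct.ι f j = 𝟙 (⨁ f) := by
        refine biproduct.hom_ext' _ _ fun i => ?_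
        rw [Preadditive.comp_sum, Finset.sum_eq_single i]
        · simp
        · intro j _ hj
          rw [biproduct.ι_π_ne_assoc _ hj.symm, zero_comp]
        · simp
      rw [h2, F.map_id, Category.id_comp]
    rw [F.map_sum, Preadditive.sum_comp] at h1
    simpa using h1.symm
  rw [key p, key q]
  exact Finset.sum_congr rfl fun j _ => by rw [h]

theorem map_ι_biproductComparison {J : Type*} [Finite J] (F : C ⥤ C) [F.Additive] (f : J → C)
    (j : J) : F.map (biproduct.ι f j) ≫ F.biproductComparison f =
      biproduct.ι (F.obj ∘ f) j := by
  classical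
  refine biproduct.hom_ext _ _ fun i => ?_
  rw [Category.assoc, Functor.biproductComparison_π, ← F.map_comp]
  by_cases h : j = i
  · subst h; simp
  · simp [biproduct.ι_π_ne _ h]

/-! ### Vector spaces times objects -/

/-- The object `V ⊗ Y` of `C` for a finite-dimensional vector space `V`: the direct sum of copies
of `Y` indexed by a basis of `V`. -/
noncomputable abbrev vecObj (k : Type*) [Field k] (V : Type*) [AddCommGroup V] [Module k V]
    (Y : C) : C :=
  ⨁ fun _ : Fin (Module.finrank k V) => Y

/-- The morphism `f ⊗ φ : V ⊗ Y ⟶ V ⊗ Z`, given by the matrix of `f` (with respect to the basis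
indexing the copies) times `φ`. -/
noncomputable def vecMap {V : Type*} [AddCommGroup V] [Module k V]
    [FiniteDimensional k V] (f : V →ₗ[k] V) {Y Z : C} (φ : Y ⟶ Z) :
    vecObj k V Y ⟶ vecObj k V Z :=
  biproduct.matrix fun j i =>
    LinearMap.toMatrix (Module.finBasis k V) (Module.finBasis k V) f i j • φ

theorem ι_vecMap {V : Type*} [AddCommGroup V] [Module k V]
    [FiniteDimensional k V] (f : V →ₗ[k] V) {Y Z : C} (φ : Y ⟶ Z)
    (j : Fin (Module.finrank k V)) :
    biproduct.ι (fun _ => Y) j ≫ vecMap f φ =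
      ∑ i, LinearMap.toMatrix (Module.finBasis k V) (Module.finBasis k V) f i j •
        φ ≫ biproduct.ι (fun _ : Fin (Module.finrank k V) => Z) i := by
  rw [vecMap, biproduct.ι_matrix, biproduct.lift_eq]
  simp

/-! ### The objects `S_{Y,π}` -/

/-- For a family of isomorphisms `c^g : ρ^g(Y) ≅ Y`, `g ∈ H`, the function `α` satisfies
`α(g,h)⁻¹ id_Y = c^g ρ^g(c^h) (ρ₂^{g,h})⁻¹ (c^{gh})⁻¹`, written without inverses of morphisms.
If `Y` is simple (and `k` algebraically closed), such an `α` exists and is unique. -/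
def IsFactorSet (A : LinearAction k G C) {H : Subgroup G} {Y : C}
    (c : ∀ h : H, (A.F h).obj Y ≅ Y) (α : H → H → kˣ) : Prop :=
  ∀ g h : H, (A.F g).map (c h).hom ≫ (c g).hom =
    (((α g h)⁻¹ : kˣ) : k) • ((A.comp (rfl : (g : G) * h = (g * h : H))).hom.app Y ≫
      (c (g * h)).hom)

theorem exists_isFactorSet [IsAlgClosed k] (A : LinearAction k G C) {H : Subgroup G} {Y : C}
    [Simple Y] [FiniteDimensional k (Y ⟶ Y)] (c : ∀ h : H, (A.F h).obj Y ≅ Y) :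
    ∃ α : H → H → kˣ, IsFactorSet A c α := by
  have key : ∀ g h : H, ∃ r : kˣ, (A.F g).map (c h).hom ≫ (c g).hom =
      ((r⁻¹ : kˣ) : k) • ((A.comp (rfl : (g : G) * h = (g * h : H))).hom.app Y ≫
        (c (g * h)).hom) := by
    intro g h
    let i : (A.F g).obj ((A.F h).obj Y) ≅ Y :=
      (A.comp (rfl : (g : G) * h = (g * h : H))).app Y ≪≫ c (g * h)
    let j : Y ≅ Y := i.symm ≪≫ (A.F g).mapIso (c h) ≪≫ c g
    obtain ⟨r, hr⟩ := endomorphism_simple_eq_smul_id k j.hom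
    have hr0 : r ≠ 0 := by
      rintro rfl
      rw [zero_smul] at hr
      have : 𝟙 Y = 0 := by rw [← j.hom_inv_id, ← hr, zero_comp]
      exact id_nonzero Y this
    refine ⟨(Units.mk0 r hr0)⁻¹, ?_⟩
    have h1 : i.hom ≫ j.hom = (A.F g).map (c h).hom ≫ (c g).hom := by simp [j]
    rw [← h1, ← hr, inv_inv, Linear.comp_smul, Category.comp_id]
    rfl
  choose α hα using key
  exact ⟨α, hα⟩

theorem IsFactorSet.comp {A : LinearAction k G C} {H : Subgroup G} {Y : C}
    {c : ∀ h : H, (A.F h).obj Y ≅ Y} {α : H → H → kˣ} (hα : IsFactorSet A c α) {g h l : H}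
    (e : g * h = l) : (A.F g).map (c h).hom ≫ (c g).hom =
      (((α g h)⁻¹ : kˣ) : k) • ((A.comp (congrArg Subtype.val e)).hom.app Y ≫ (c l).hom) := by
  subst e
  exact hα g h

theorem IsFactorSet.unit_comp {A : LinearAction k G C} {H : Subgroup G} {Y : C}
    {c : ∀ h : H, (A.F h).obj Y ≅ Y} {α : H → H → kˣ} (hα : IsFactorSet A c α) :
    A.unit.hom.app Y ≫ (c 1).hom = (((α 1 1)⁻¹ : kˣ) : k) • 𝟙 Y := by
  have h1 := hα.comp (one_mul (1 : H))
  rw [← Linear.smul_comp, cancel_mono] at h1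
  have h2 := A.unit.hom.naturality (c 1).hom
  have h3 := A.unit_left 1 Y
  simp only [Functor.id_map] at h2
  have h4 : (c 1).hom ≫ A.unit.hom.app Y = (((α 1 1)⁻¹ : kˣ) : k) • 𝟙 _ := by
    rw [h2]
    refine (congrArg (A.unit.hom.app _ ≫ ·) h1).trans ?_
    rw [Linear.comp_smul]
    exact congrArg _ h3
  have h5 : A.unit.hom.app Y = (((α 1 1)⁻¹ : kˣ) : k) • (c 1).inv := by
    rw [← cancel_epi (c 1).hom, h4]
    simp
  rw [h5]
  simp

/-- The `H`-equivariant structure `π(g) ⊗ c^g : ρ^g(V ⊗ Y) = V ⊗ ρ^g(Y) ⟶ V ⊗ Y`. -/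
noncomputable def vecStr (A : LinearAction k G C) {H : Subgroup G} {Y : C}
    (c : ∀ h : H, (A.F h).obj Y ≅ Y) {α : H → H → kˣ}
    {V : Type*} [AddCommGroup V] [Module k V] [FiniteDimensional k V] (π : ProjRep α V) (g : H) :
    (A.F g).obj (vecObj k V Y) ⟶ vecObj k V Y :=
  (A.F g).biproductComparison (fun _ : Fin (Module.finrank k V) => Y) ≫
    vecMap (π.toFun g).toLinearMap (c g).hom

theorem ι_vecStr (A : LinearAction k G C) {H : Subgroup G} {Y : C}
    (c : ∀ h : H, (A.F h).obj Y ≅ Y) {α : H → H → kˣ}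
    {V : Type*} [AddCommGroup V] [Module k V] [FiniteDimensional k V] (π : ProjRep α V) (g : H)
    (j : Fin (Module.finrank k V)) :
    (A.F g).map (biproduct.ι (fun _ => Y) j) ≫ vecStr A c π g =
      ∑ i, LinearMap.toMatrix (Module.finBasis k V) (Module.finBasis k V)
        (π.toFun g).toLinearMap i j •
          (c g).hom ≫ biproduct.ι (fun _ : Fin (Module.finrank k V) => Y) i := by
  rw [vecStr, reassoc_of% map_ι_biproductComparison]
  exact ι_vecMap _ _ _

theorem toMatrix_mul_smul {H : Type*} [Group H] {α : H → H → kˣ} {V : Type*} [AddCommGroup V]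
    [Module k V] [FiniteDimensional k V] (π : ProjRep α V) (g h : H)
    (l j : Fin (Module.finrank k V)) :
    ∑ i, LinearMap.toMatrix (Module.finBasis k V) (Module.finBasis k V)
        (π.toFun g).toLinearMap l i *
      LinearMap.toMatrix (Module.finBasis k V) (Module.finBasis k V)
        (π.toFun h).toLinearMap i j =
    α g h * LinearMap.toMatrix (Module.finBasis k V) (Module.finBasis k V)
        (π.toFun (g * h)).toLinearMap l j := by
  have h1 : (π.toFun g).toLinearMap ∘ₗ (π.toFun h).toLinearMap =
      (α g h : k) • (π.toFun (g * h)).toLinearMap := by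
    ext v; exact π.map_mul g h v
  have h2 := congrArg (LinearMap.toMatrix (Module.finBasis k V) (Module.finBasis k V)) h1
  rw [LinearMap.toMatrix_comp _ (Module.finBasis k V), map_smul] at h2
  exact congrFun (congrFun h2 l) j

/-- The `H`-equivariant object `(V ⊗ Y, (π(g) ⊗ c^g)_g)` of `C^H`, for a projective representation
`π` of `H` on `V` whose factor set is that of the family `c`. -/
noncomputable def vecEquivObj (A : LinearAction k G C) {H : Subgroup G} {Y : C}
    (c : ∀ h : H, (A.F h).obj Y ≅ Y) {α : H → H → kˣ} (hα : IsFactorSet A c α)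
    {V : Type*} [AddCommGroup V] [Module k V] [FiniteDimensional k V] (π : ProjRep α V) :
    EquivObj (A.restrict H) where
  X := vecObj k V Y
  μ g := vecStr A c π g
  comp := by
    rintro g h _ rfl
    let τ : A.F h ⋙ A.F g ⟶ A.F (g * h : H) := (A.comp rfl).hom
    refine map_biproduct_hom_ext (A.F h ⋙ A.F g) fun j => ?_
    change (A.F g).map ((A.F h).map _) ≫ (A.F g).map (vecStr A c π h) ≫ vecStr A c π g =
      (A.F h ⋙ A.F g).map _ ≫ τ.app _ ≫ vecStr A c π (g * h)
    have hc : (A.F g).map (c h).hom ≫ (c g).hom =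
        (((α g h)⁻¹ : kˣ) : k) • (τ.app Y ≫ (c (g * h)).hom) := hα g h
    rw [← Functor.map_comp_assoc, NatTrans.naturality_assoc, ι_vecStr, ι_vecStr,
      Functor.map_sum, Preadditive.sum_comp, Preadditive.comp_sum]
    simp only [Functor.map_smul, Functor.map_comp, Linear.smul_comp, Category.assoc, ι_vecStr,
      Preadditive.comp_sum, Linear.comp_smul, Finset.smul_sum, smul_smul]
    rw [Finset.sum_comm]
    refine Finset.sum_congr rfl fun l _ => ?_
    rw [← Finset.sum_smul]
    have h1 := toMatrix_mul_smul π g h l j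
    simp only [mul_comm] at h1 ⊢
    rw [h1, ← Category.assoc, hc]
    rw [Linear.smul_comp, smul_smul, mul_right_comm, Units.mul_inv, one_mul, Category.assoc]
  unit := by
    refine biproduct.hom_ext' _ _ fun j => ?_
    change _ ≫ A.unit.hom.app (vecObj k V Y) ≫ vecStr A c π 1 = _
    have hn := A.unit.hom.naturality (biproduct.ι (fun _ : Fin (Module.finrank k V) => Y) j)
    simp only [Functor.id_map] at hn
    rw [reassoc_of% hn]
    refine (congrArg (A.unit.hom.app Y ≫ ·) (ι_vecStr A c π 1 j)).trans ?_
    have h1 : (π.toFun 1).toLinearMap = (α 1 1 : k) • LinearMap.id :=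
      LinearMap.ext fun v => π.map_one v
    rw [h1, map_smul, LinearMap.toMatrix_id, Preadditive.comp_sum]
    simp only [Linear.comp_smul, ← Category.assoc]
    rw [hα.unit_comp]
    simp [Matrix.one_apply, smul_smul]

/-! ### Induction from `C^H` to `C^G` -/

section Induction

variable {A : LinearAction k G C} {H : Subgroup G}

/-- The structure morphism `ν^h : ρ^h(N) ⟶ N` of an object of `C^H`. -/
def resμ (N : EquivObj (A.restrict H)) (h : H) : (A.F (h : G)).obj N.X ⟶ N.X :=
  N.μ h

/-- For `g t = s h`, the component `ρ^s(ν^h) (ρ₂^{s,h})⁻¹ ρ₂^{g,t} : ρ^g ρ^t(N) ⟶ ρ^s(N)`. -/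
def indMap (N : EquivObj (A.restrict H)) (g t s : G) (h : H)
    (e : s * h = g * t) : (A.F g).obj ((A.F t).obj N.X) ⟶ (A.F s).obj N.X :=
  (A.comp (rfl : g * t = g * t)).hom.app N.X ≫ (A.comp e).inv.app N.X ≫ (A.F s).map (resμ N h)

theorem indMap_comp (N : EquivObj (A.restrict H)) (a b t s s' : G) (h h' : H)
    (e : s * h = b * t) (e' : s' * h' = a * s) (e'' : s' * (h' * h : H) = a * b * t) :
    (A.F a).map (indMap N b t s h e) ≫ indMap N a s s' h' e' =
      (A.comp (rfl : a * b = a * b)).hom.app ((A.F t).obj N.X) ≫ indMap N (a * b) t s' _ e'' := by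
  have e4 : a * s * h = a * b * t := by rw [mul_assoc, e, mul_assoc]
  have i1 := A.assoc (rfl : a * b = a * b) (rfl : b * t = b * t) (rfl : a * b * t = a * b * t)
    (mul_assoc a b t).symm N.X
  have i2 := A.assoc (rfl : a * s = a * s) e e4 (mul_assoc a b t).symm N.X
  have i3 := A.assoc e' (rfl : (h' : G) * h = (h' * h : H)) e4 e'' N.X
  have n1 := (A.comp (rfl : a * s = a * s)).hom.naturality (resμ N h)
  have n2 := (A.comp e').inv.naturality (resμ N h)
  have hN : (A.F h').map (resμ N h) ≫ resμ N h' =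
    (A.comp (rfl : (h' : G) * h = (h' * h : H))).hom.app N.X ≫ resμ N (h' * h) := N.comp rfl
  have hN' := congrArg (A.F s').map hN
  simp only [Functor.map_comp] at hN'
  rw [Functor.comp_map] at n1
  rw [Functor.comp_map] at n2
  simp only [indMap, Functor.map_comp, Category.assoc]
  rw [reassoc_of% n1, reassoc_of% n2, hN', reassoc_of% i1]
  simp only [← Category.assoc]
  congr 1
  simp only [Category.assoc]
  rw [← cancel_mono ((A.comp e'').hom.app N.X)]
  simp only [Category.assoc, Iso.inv_hom_id_app, Category.comp_id]
  rw [← i3, Iso.inv_hom_id_app_assoc, i2, ← Functor.map_comp_assoc, ← Functor.map_comp_assoc]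
  simp

theorem indMap_unit (N : EquivObj (A.restrict H)) (t : G) :
    A.unit.hom.app ((A.F t).obj N.X) ≫ indMap N 1 t t 1 (by simp) = 𝟙 _ := by
  have u : A.unit.hom.app N.X ≫ resμ N 1 = 𝟙 _ := N.unit
  have key : ∀ (l : G) (e₁ : 1 * t = l) (e₂ : t * 1 = l), A.unit.hom.app ((A.F t).obj N.X) ≫
      (A.comp e₁).hom.app N.X ≫ (A.comp e₂).inv.app N.X ≫ (A.F t).map (resμ N 1) = 𝟙 ((A.F t).obj N.X) := by
    intro l e₁ e₂
    obtain rfl : l = t := by rw [← e₂, mul_one]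
    have h1 : (A.F l).map (A.unit.hom.app N.X) = (A.comp e₂).inv.app N.X := by
      rw [← cancel_mono ((A.comp e₂).hom.app N.X), Iso.inv_hom_id_app]
      exact A.unit_right l N.X
    have h2 := A.unit_left l N.X
    rw [reassoc_of% h2, ← h1]
    have h3 := congrArg (A.F l).map u
    rw [Functor.map_comp] at h3
    exact h3.trans ((A.F l).map_id _)
  exact key _ rfl _

variable [Finite G]

/-- The morphism `μ^g : ⨁_t ρ^g ρ^t(N) ⟶ ⨁_t ρ^t(N)` whose component on `ρ^g ρ^t(N)` is
`indMap N g t s h`, where `g t = s h` with `s ∈ R` and `h ∈ H`. -/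
noncomputable def indStr (N : EquivObj (A.restrict H)) {R : Set G}
    (hR : Subgroup.IsComplement R (H : Set G)) (g : G) :
    (A.F g).obj (⨁ fun t : R => (A.F t).obj N.X) ⟶ ⨁ fun t : R => (A.F t).obj N.X :=
  (A.F g).biproductComparison (fun t : R => (A.F t).obj N.X) ≫
    biproduct.desc fun t : R =>
      indMap N g t (hR.equiv (g * t)).1 (hR.equiv (g * t)).2 (hR.equiv_fst_mul_equiv_snd _) ≫
        biproduct.ι (fun t : R => (A.F t).obj N.X) (hR.equiv (g * t)).1

theorem ι_indStr (N : EquivObj (A.restrict H)) {R : Set G}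
    (hR : Subgroup.IsComplement R (H : Set G)) (g : G) (t s : R) (h : H)
    (e : (s : G) * h = g * t) :
    (A.F g).map (biproduct.ι (fun t : R => (A.F t).obj N.X) t) ≫ indStr N hR g =
      indMap N g t s h e ≫ biproduct.ι (fun t : R => (A.F t).obj N.X) s := by
  have he : hR.equiv (g * t) = (s, h) := by
    rw [← Equiv.eq_symm_apply]
    exact e.symm
  obtain ⟨h1, h2⟩ := Prod.ext_iff.1 he
  dsimp only at h1 h2
  subst h1 h2
  rw [indStr, reassoc_of% map_ι_biproductComparison]
  exact biproduct.ι_desc _ _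

/-- The object `L^R(N, ν) = (⨁_{t ∈ R} ρ^t(N), μ)` of `C^G` induced from an object `(N, ν)` of
`C^H`, where `R` is a set of representatives of the left cosets of `H` in `G`. -/
noncomputable def induced (N : EquivObj (A.restrict H)) {R : Set G}
    (hR : Subgroup.IsComplement R (H : Set G)) : EquivObj A where
  X := ⨁ fun t : R => (A.F t).obj N.X
  μ g := indStr N hR g
  comp := by
    rintro a b _ rfl
    refine map_biproduct_hom_ext (A.F b ⋙ A.F a) fun t => ?_
    obtain ⟨⟨s, h⟩, hs⟩ := hR.2 (b * t)
    obtain ⟨⟨s', h'⟩, hs'⟩ := hR.2 (a * s)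
    dsimp only at hs hs'
    have e3 : (s' : G) * (⟨h', h'.2⟩ * ⟨h, h.2⟩ : H) = a * b * t := by
      simp only [Subgroup.coe_mul, ← mul_assoc, hs']
      rw [mul_assoc, hs, mul_assoc]
    change (A.F a).map ((A.F b).map _) ≫ (A.F a).map _ ≫ _ =
      (A.F b ⋙ A.F a).map _ ≫ (A.comp rfl).hom.app _ ≫ _
    rw [← Functor.map_comp_assoc, NatTrans.naturality_assoc, ι_indStr N hR b t s h hs,
      Functor.map_comp_assoc, ι_indStr N hR a s s' h' hs',
      ι_indStr N hR (a * b) t s' _ e3]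
    rw [← Category.assoc, ← Category.assoc]
    congr 1
    exact indMap_comp N a b t s s' h h' hs hs' e3
  unit := by
    refine biproduct.hom_ext' _ _ fun t => ?_
    have hn := A.unit.hom.naturality (biproduct.ι (fun t : R => (A.F t).obj N.X) t)
    simp only [Functor.id_map] at hn
    rw [reassoc_of% hn, ι_indStr N hR 1 t t 1 (by simp), ← Category.assoc]
    refine (congrArg (· ≫ _) (indMap_unit N t)).trans ?_
    simp

end Induction

end Clifford

end Linear

section Tensor

open Functor.LaxMonoidal Functor.OplaxMonoidal Functor.Monoidal

variable {k : Type*} [Field k] {G : Type*} [Group G] {C : Type u} [Category.{v} C]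

section Monoidal

variable [Preadditive C] [Linear k C] [MonoidalCategory C] {A : TensorAction k G C}

/-! ### The tensor product of `C^G` -/

theorem TensorAction.comp_δ (A : TensorAction k G C) {g h l : G} (e : g * h = l) (X Y : C) :
    (A.comp e).hom.app (X ⊗ Y) ≫ δ (A.F l) X Y =
      (A.F g).map (δ (A.F h) X Y) ≫ δ (A.F g) _ _ ≫
        ((A.comp e).hom.app X ⊗ₘ (A.comp e).hom.app Y) := by
  have h1 := NatTrans.IsMonoidal.tensor (τ := (A.comp e).hom) X Y
  rw [← cancel_epi (μ (A.F h ⋙ A.F g) X Y), reassoc_of% h1]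
  simp

theorem TensorAction.comp_η (A : TensorAction k G C) {g h l : G} (e : g * h = l) :
    (A.comp e).hom.app (𝟙_ C) ≫ η (A.F l) = (A.F g).map (η (A.F h)) ≫ η (A.F g) := by
  have h1 := NatTrans.IsMonoidal.unit (τ := (A.comp e).hom)
  rw [← cancel_epi (ε (A.F h ⋙ A.F g)), reassoc_of% h1]
  simp

theorem TensorAction.unit_δ (A : TensorAction k G C) (X Y : C) :
    A.unit.hom.app (X ⊗ Y) ≫ δ (A.F 1) X Y = A.unit.hom.app X ⊗ₘ A.unit.hom.app Y := by
  have h1 := NatTrans.IsMonoidal.tensor (τ := A.unit.hom) X Y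
  rw [← cancel_mono (μ (A.F 1) X Y), ← h1]
  simp

theorem TensorAction.unit_η (A : TensorAction k G C) :
    A.unit.hom.app (𝟙_ C) ≫ η (A.F 1) = 𝟙 _ := by
  have h1 := NatTrans.IsMonoidal.unit (τ := A.unit.hom)
  have h2 : ε (𝟭 C) = 𝟙 (𝟙_ C) := rfl
  rw [h2, Category.id_comp] at h1
  exact (congrArg (· ≫ η (A.F 1)) h1).trans (ε_η (A.F 1))

/-- The tensor product `(X, μ_X) ⊗ (Y, μ_Y) = (X ⊗ Y, (μ_X ⊗ μ_Y) ρ₂)` of `C^G`. -/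
def tensorEquivObj (M N : EquivObj A.toLinearAction) : EquivObj A.toLinearAction where
  X := M.X ⊗ N.X
  μ g := δ (A.F g) M.X N.X ≫ (M.μ g ⊗ₘ N.μ g)
  comp {g h l} e := by
    rw [reassoc_of% A.comp_δ e, Functor.map_comp, Category.assoc, ← δ_natural_assoc,
      tensorHom_comp_tensorHom, tensorHom_comp_tensorHom, M.comp e, N.comp e]
  unit := by
    rw [reassoc_of% A.unit_δ, tensorHom_comp_tensorHom]
    refine (congrArg₂ (· ⊗ₘ ·) M.unit N.unit).trans (id_tensorHom_id _ _)

/-- The unit object of `C^G`. -/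
def unitEquivObj (A : TensorAction k G C) : EquivObj A.toLinearAction where
  X := 𝟙_ C
  μ g := η (A.F g)
  comp e := (A.comp_η e).symm
  unit := A.unit_η

/-- An isomorphism of `C` compatible with the equivariant structures is one of `C^G`. -/
@[simps]
def EquivObj.mkIso {B : LinearAction k G C} {M N : EquivObj B} (i : M.X ≅ N.X)
    (h : ∀ g, M.μ g ≫ i.hom = (B.F g).map i.hom ≫ N.μ g) : M ≅ N where
  hom := ⟨i.hom, h⟩
  inv := ⟨i.inv, fun g => by
    rw [Iso.comp_inv_eq, Category.assoc, h, ← Functor.map_comp_assoc]; simp⟩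
  hom_inv_id := EquivObj.hom_ext i.hom_inv_id
  inv_hom_id := EquivObj.hom_ext i.inv_hom_id

theorem EquivObj.Hom.tensor_comm {M M' N N' : EquivObj A.toLinearAction} (p : M ⟶ M')
    (q : N ⟶ N') (g : G) : (δ (A.F g) M.X N.X ≫ (M.μ g ⊗ₘ N.μ g)) ≫ (p.f ⊗ₘ q.f) =
      (A.F g).map (p.f ⊗ₘ q.f) ≫ δ (A.F g) M'.X N'.X ≫ (M'.μ g ⊗ₘ N'.μ g) := by
  rw [← δ_natural_assoc, Category.assoc, tensorHom_comp_tensorHom, tensorHom_comp_tensorHom,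
    p.comm, q.comm]

theorem tensor_assoc_comm (L M N : EquivObj A.toLinearAction) (g : G) :
    (tensorEquivObj (tensorEquivObj L M) N).μ g ≫ (α_ L.X M.X N.X).hom =
      (A.F g).map (α_ L.X M.X N.X).hom ≫ (tensorEquivObj L (tensorEquivObj M N)).μ g := by
  have h := Functor.OplaxMonoidal.associativity (A.F g) L.X M.X N.X
  change (δ (A.F g) (L.X ⊗ M.X) N.X ≫
      ((δ (A.F g) L.X M.X ≫ (L.μ g ⊗ₘ M.μ g)) ⊗ₘ N.μ g)) ≫ _ =
    _ ≫ δ (A.F g) L.X (M.X ⊗ N.X) ≫ (L.μ g ⊗ₘ (δ (A.F g) M.X N.X ≫ (M.μ g ⊗ₘ N.μ g)))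
  have e1 : ((δ (A.F g) L.X M.X ≫ (L.μ g ⊗ₘ M.μ g)) ⊗ₘ N.μ g) =
      δ (A.F g) L.X M.X ▷ _ ≫ ((L.μ g ⊗ₘ M.μ g) ⊗ₘ N.μ g) := by
    rw [← tensorHom_id, tensorHom_comp_tensorHom, Category.id_comp]
  have e2 : (L.μ g ⊗ₘ (δ (A.F g) M.X N.X ≫ (M.μ g ⊗ₘ N.μ g))) =
      _ ◁ δ (A.F g) M.X N.X ≫ (L.μ g ⊗ₘ (M.μ g ⊗ₘ N.μ g)) := by
    rw [← id_tensorHom, tensorHom_comp_tensorHom, Category.id_comp]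
  rw [e1, e2, Category.assoc, Category.assoc, associator_naturality, reassoc_of% h]

theorem unit_tensor_comm (M : EquivObj A.toLinearAction) (g : G) :
    (tensorEquivObj (unitEquivObj A) M).μ g ≫ (λ_ M.X).hom =
      (A.F g).map (λ_ M.X).hom ≫ M.μ g := by
  have h := Functor.OplaxMonoidal.left_unitality_hom (A.F g) M.X
  change (δ (A.F g) (𝟙_ C) M.X ≫ (η (A.F g) ⊗ₘ M.μ g)) ≫ _ = _
  rw [MonoidalCategory.tensorHom_def, Category.assoc, Category.assoc, leftUnitor_naturality,
    reassoc_of% h]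

theorem tensor_unit_comm (M : EquivObj A.toLinearAction) (g : G) :
    (tensorEquivObj M (unitEquivObj A)).μ g ≫ (ρ_ M.X).hom =
      (A.F g).map (ρ_ M.X).hom ≫ M.μ g := by
  have h := Functor.OplaxMonoidal.right_unitality_hom (A.F g) M.X
  change (δ (A.F g) M.X (𝟙_ C) ≫ (M.μ g ⊗ₘ η (A.F g))) ≫ _ = _
  rw [tensorHom_def', Category.assoc, Category.assoc, rightUnitor_naturality,
    reassoc_of% h]

instance : MonoidalCategoryStruct (EquivObj A.toLinearAction) where
  tensorObj M N := tensorEquivObj M N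
  tensorUnit := unitEquivObj A
  tensorHom p q := ⟨p.f ⊗ₘ q.f, fun g => EquivObj.Hom.tensor_comm p q g⟩
  whiskerLeft M _ _ q := ⟨M.X ◁ q.f, fun g => by
    have := EquivObj.Hom.tensor_comm (𝟙 M) q g
    rwa [show (𝟙 M : M ⟶ M).f = 𝟙 M.X from rfl, id_tensorHom] at this⟩
  whiskerRight p N := ⟨p.f ▷ N.X, fun g => by
    have := EquivObj.Hom.tensor_comm p (𝟙 N) g
    rwa [show (𝟙 N : N ⟶ N).f = 𝟙 N.X from rfl, tensorHom_id] at this⟩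
  associator L M N := EquivObj.mkIso (α_ L.X M.X N.X) (tensor_assoc_comm L M N)
  leftUnitor M := EquivObj.mkIso (λ_ M.X) (unit_tensor_comm M)
  rightUnitor M := EquivObj.mkIso (ρ_ M.X) (tensor_unit_comm M)

/-- The monoidal category `C^G`; associativity and unit constraints are those of `C`. -/
instance : MonoidalCategory (EquivObj A.toLinearAction) :=
  Monoidal.induced (EquivObj.forget A.toLinearAction)
    { μIso := fun _ _ => Iso.refl _
      εIso := Iso.refl _
      whiskerLeft_eq := fun M _ _ q => by
        change M.X ◁ q.f = 𝟙 _ ≫ M.X ◁ q.f ≫ 𝟙 _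
        simp
      whiskerRight_eq := fun p N => by
        change p.f ▷ N.X = 𝟙 _ ≫ p.f ▷ N.X ≫ 𝟙 _
        simp
      tensorHom_eq := fun p q => by
        change (p.f ⊗ₘ q.f) = 𝟙 _ ≫ (p.f ⊗ₘ q.f) ≫ 𝟙 _
        simp
      associator_eq := fun L M N => by
        change (α_ L.X M.X N.X).hom = (𝟙 _ ≫ (𝟙 _ ⊗ₘ 𝟙 _)) ≫ (α_ L.X M.X N.X).hom ≫
          (𝟙 _ ⊗ₘ 𝟙 _) ≫ 𝟙 _
        simp
      leftUnitor_eq := fun M => by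
        change (λ_ M.X).hom = (𝟙 _ ≫ (𝟙 _ ⊗ₘ 𝟙 _)) ≫ (λ_ M.X).hom
        simp
      rightUnitor_eq := fun M => by
        change (ρ_ M.X).hom = (𝟙 _ ≫ (𝟙 _ ⊗ₘ 𝟙 _)) ≫ (ρ_ M.X).hom
        simp }

/-! ### Duality -/

/-- A monoidal functor preserves duals. -/
@[reducible]
def mapExactPairing (F : C ⥤ C) [F.Monoidal] (X Y : C) [ExactPairing X Y] :
    ExactPairing (F.obj X) (F.obj Y) where
  evaluation' := μ F Y X ≫ F.map (ε_ X Y) ≫ η F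
  coevaluation' := ε F ≫ F.map (η_ X Y) ≫ δ F X Y
  coevaluation_evaluation' := by
    have key : ∀ (f : 𝟙_ C ⟶ X ⊗ Y) (e : Y ⊗ X ⟶ 𝟙_ C),
        F.obj Y ◁ F.map f ≫ F.obj Y ◁ δ F X Y ≫ (α_ (F.obj Y) (F.obj X) (F.obj Y)).inv ≫
          μ F Y X ▷ F.obj Y ≫ F.map e ▷ F.obj Y =
        μ F Y (𝟙_ C) ≫ F.map (Y ◁ f ≫ (α_ Y X Y).inv ≫ e ▷ Y) ≫ δ F (𝟙_ C) Y := by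
      intro f e
      rw [Functor.Monoidal.map_associator_inv']
      simp only [Category.assoc, whiskerLeft_δ_μ_assoc, whiskerRight_δ_μ_assoc,
        μ_natural_right_assoc, Functor.map_comp, δ_natural_left]
    have h := key (η_ X Y) (ε_ X Y)
    rw [ExactPairing.coevaluation_evaluation] at h
    simp only [MonoidalCategory.whiskerLeft_comp, comp_whiskerRight, Category.assoc]
    rw [reassoc_of% h]
    simp
  evaluation_coevaluation' := by
    have key : ∀ (f : 𝟙_ C ⟶ X ⊗ Y) (e : Y ⊗ X ⟶ 𝟙_ C),
        F.map f ▷ F.obj X ≫ δ F X Y ▷ F.obj X ≫ (α_ (F.obj X) (F.obj Y) (F.obj X)).hom ≫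
          F.obj X ◁ μ F Y X ≫ F.obj X ◁ F.map e =
        μ F (𝟙_ C) X ≫ F.map (f ▷ X ≫ (α_ X Y X).hom ≫ X ◁ e) ≫ δ F X (𝟙_ C) := by
      intro f e
      rw [Functor.Monoidal.map_associator']
      simp only [Category.assoc, whiskerLeft_δ_μ_assoc, whiskerRight_δ_μ_assoc,
        μ_natural_left_assoc, Functor.map_comp, δ_natural_right]
    have h := key (η_ X Y) (ε_ X Y)
    rw [ExactPairing.evaluation_coevaluation] at h
    simp only [MonoidalCategory.whiskerLeft_comp, comp_whiskerRight, Category.assoc]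
    rw [reassoc_of% h]
    simp

/-- For isomorphisms `c^g : ρ^g(Y) ≅ Y`, the isomorphisms `ρ^g(Y^*) ≅ Y^*` obtained by duality:
the composite of `ρ^g(Y^*) ≅ ρ^g(Y)^*` with the inverse of the transpose of `c^g`. -/
def dualFamily [RightRigidCategory C] (A : TensorAction k G C) {H : Subgroup G} {Y : C}
    (c : ∀ h : H, (A.F h).obj Y ≅ Y) (h : H) : (A.F h).obj Yᘁ ≅ Yᘁ :=
  rightDualIso
    (letI := mapExactPairing (A.F h) Y Yᘁ
     exactPairingCongrLeft (c h).symm)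
    HasRightDual.exact

/-- `dualFamily` is characterized by compatibility of the evaluation `Y^* ⊗ Y ⟶ 1` with the
isomorphisms. -/
theorem dualFamily_evaluation [RightRigidCategory C] (A : TensorAction k G C) {H : Subgroup G}
    {Y : C} (c : ∀ h : H, (A.F h).obj Y ≅ Y) (h : H) :
    ((dualFamily A c h).hom ⊗ₘ (c h).hom) ≫ ε_ Y Yᘁ =
      μ (A.F h) Yᘁ Y ≫ (A.F h).map (ε_ Y Yᘁ) ≫ η (A.F h) := by
  have h1 : (dualFamily A c h).hom ▷ Y ≫ ε_ Y Yᘁ =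
      (A.F h).obj Yᘁ ◁ (c h).inv ≫ μ (A.F h) Yᘁ Y ≫ (A.F h).map (ε_ Y Yᘁ) ≫ η (A.F h) := by
    let p₀ := mapExactPairing (A.F h) Y Yᘁ
    let p : ExactPairing Y ((A.F h).obj Yᘁ) := exactPairingCongrLeft (c h).symm
    have h2 := @rightAdjointMate_comp_evaluation C _ _ Y Y ⟨Yᘁ⟩ ⟨(A.F h).obj Yᘁ⟩ (𝟙 Y)
    rw [MonoidalCategory.whiskerLeft_id, Category.id_comp] at h2
    exact h2
  rw [tensorHom_def', Category.assoc, h1, ← MonoidalCategory.whiskerLeft_comp_assoc]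
  simp

end Monoidal

section Simple

variable [Abelian C] [Linear k C] [MonoidalCategory C] [Finite G]

/-- The object `S_{Y,π} = L^R(V ⊗ Y)` of `C^G`, for `H = G_Y`, a family of isomorphisms
`c^g : ρ^g(Y) ≅ Y` with factor set `α`, a projective representation `π` on `V` with factor set
`α`, and a set `R` of left coset representatives. -/
noncomputable def S (A : TensorAction k G C) {H : Subgroup G} {Y : C}
    (c : ∀ h : H, (A.F h).obj Y ≅ Y) {α : H → H → kˣ} (hα : IsFactorSet A.toLinearAction c α)
    {V : Type*} [AddCommGroup V] [Module k V] [FiniteDimensional k V] (π : ProjRep α V)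
    {R : Set G} (hR : Subgroup.IsComplement R (H : Set G)) : EquivObj A.toLinearAction :=
  induced (vecEquivObj A.toLinearAction c hα π) hR

end Simple

end Tensor

end Equivariantization

open Equivariantization

/-! The canonical pairing of V^* with V and the evaluation of Y^* with Y combine to a pairing of V^*
⊗ Y^* with V ⊗ Y. The isomorphism (c^*)^h is the one which, together with c^h, preserves the
evaluation of Y (`dualFamily_pairing`), and π^*(h), π(h) preserve the canonical pairing of V^* and
V. Hence V^* ⊗ Y^* is dual to V ⊗ Y compatibly with the structures of G_Y-equivariant objects
(`vecStr_pairing`). Testing against the evaluation also shows that c^* has factor set α⁻¹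
(`isFactorSet_dualFamily`).

Induction preserves duality (`nonempty_exactPairing_induced`). Each ρ^t is monoidal and carries a
pairing to a pairing; the direct sum over R pairs summands of equal index, and this is invariant
because G permutes the cosets and ρ₂ is monoidal. Another set R' gives an isomorphic induced object
(`inducedIso`). Only the evaluation has to be checked for equivariance: an evaluation determines its
coevaluation, which is then equivariant as well (`equivariantExactPairing`).

For arbitrary c', Schur's lemma gives c' = f c^* with scalars f(h). With σ = f⁻¹ π^* the scalars
cancel in σ(h) ⊗ c'^h, so the object built from (c', σ) is the one built from (c^*, π^*)
(`S_rescale`).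

Simplicity of Y^* comes from passing to mates of subobjects (`simple_rightDual`), irreducibility of
π^* from annihilators (`ProjRep.Irreducible.dual`). -/

namespace Equivariantization

/-! ### Exact pairings and their finite direct sums -/

section ExactPairings

variable {C : Type u} [Category.{v} C] [MonoidalCategory C]

/-- A morphism into the dual is determined by its pairing with the object. -/
theorem whiskerRight_evaluation_cancel {X Y Z : C} [ExactPairing X Y] {f g : Z ⟶ Y}
    (h : f ▷ X ≫ ε_ X Y = g ▷ X ≫ ε_ X Y) : f = g := by
  apply (tensorRightHomEquiv Z X Y (𝟙_ C)).symm.injective.comp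
    (show Function.Injective fun f : Z ⟶ Y => f ≫ (λ_ Y).inv from fun a b hab => by
      simpa using hab)
  have key : ∀ f : Z ⟶ Y, (tensorRightHomEquiv Z X Y (𝟙_ C)).symm (f ≫ (λ_ Y).inv) =
      f ▷ X ≫ ε_ X Y := by
    intro f
    simp only [tensorRightHomEquiv, Equiv.coe_fn_symm_mk]
    monoidal
  simp only [Function.comp_apply, key, h]

/-- The coevaluation of an exact pairing is determined by its evaluation. -/
theorem coevaluation_eq_of_evaluation_eq {X Y : C} (p q : ExactPairing X Y)
    (h : p.evaluation' = q.evaluation') : p.coevaluation' = q.coevaluation' := by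
  -- Transposed along the common evaluation, each coevaluation becomes one side of a triangle
  -- identity, hence the same canonical map.
  apply (@tensorRightHomEquiv C _ _ (𝟙_ C) X Y X p).symm.injective
  have hp := p.evaluation_coevaluation'
  have hq := q.evaluation_coevaluation'
  rw [← h] at hq
  change p.coevaluation' ▷ X ≫ (α_ _ _ _).hom ≫ X ◁ p.evaluation' ≫ (ρ_ _).hom =
    q.coevaluation' ▷ X ≫ (α_ _ _ _).hom ≫ X ◁ p.evaluation' ≫ (ρ_ _).hom
  rw [reassoc_of% hp, reassoc_of% hq]

theorem exactPairingCongr_evaluation {X X' Y Y' : C} [ExactPairing X' Y'] (i : X ≅ X')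
    (j : Y ≅ Y') :
    (exactPairingCongr i j).evaluation' = (j.hom ⊗ₘ i.hom) ≫ ε_ X' Y' := by
  change Y ◁ i.hom ≫ j.hom ▷ X' ≫ ε_ X' Y' = _
  rw [tensorHom_def', Category.assoc]

theorem exactPairingCongr_coevaluation {X X' Y Y' : C} [ExactPairing X' Y'] (i : X ≅ X')
    (j : Y ≅ Y') :
    (exactPairingCongr i j).coevaluation' = η_ X' Y' ≫ (i.inv ⊗ₘ j.inv) := by
  change (η_ X' Y' ≫ X' ◁ j.inv) ≫ i.inv ▷ Y = _
  rw [tensorHom_def', Category.assoc]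

/-- By naturality of the associator, `a` and `c` meet in the composite `a ≫ c`. For `a` an inclusion
and `c` a projection of a direct sum, this composite is zero or an identity, so the double sum in
the triangle identity for a direct sum of pairings collapses to the triangle identities of the
summands. -/
theorem zigzag_factor {X Y X₁ Y₁ X₂ Y₂ : C} (n : 𝟙_ C ⟶ X₁ ⊗ Y₁)
    (e : Y₂ ⊗ X₂ ⟶ 𝟙_ C) (a : X₁ ⟶ X) (b : Y₁ ⟶ Y) (c : X ⟶ X₂) (d : Y ⟶ Y₂) :
    Y ◁ (n ≫ (a ⊗ₘ b)) ≫ (α_ _ _ _).inv ≫ ((d ⊗ₘ c) ≫ e) ▷ Y =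
      d ▷ _ ≫ Y₂ ◁ (n ≫ ((a ≫ c) ▷ Y₁)) ≫ (α_ _ _ _).inv ≫ e ▷ Y₁ ≫ _ ◁ b := by
  have h1 : ((d ⊗ₘ (a ≫ c)) ⊗ₘ b) = ((𝟙 Y ⊗ₘ a) ⊗ₘ b) ≫ ((d ⊗ₘ c) ⊗ₘ 𝟙 Y) := by
    simp only [tensorHom_comp_tensorHom, Category.id_comp, Category.comp_id]
  have h2 : ((d ⊗ₘ (a ≫ c)) ⊗ₘ b) =
      ((d ⊗ₘ (a ≫ c)) ⊗ₘ 𝟙 Y₁) ≫ ((𝟙 _ ⊗ₘ 𝟙 _) ⊗ₘ b) := by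
    simp only [tensorHom_comp_tensorHom, Category.id_comp, Category.comp_id]
  have h3 := associator_inv_naturality (𝟙 Y) a b
  have h4 := associator_inv_naturality d (a ≫ c) (𝟙 Y₁)
  trans Y ◁ n ≫ (α_ _ _ _).inv ≫ ((d ⊗ₘ (a ≫ c)) ⊗ₘ b) ≫ e ▷ Y
  · rw [h1, Category.assoc, ← reassoc_of% h3]
    simp only [← id_tensorHom, ← tensorHom_id, tensorHom_comp_tensorHom, Category.id_comp,
      tensorHom_comp_tensorHom_assoc]
  · rw [h2, Category.assoc, ← reassoc_of% h4]
    simp only [← id_tensorHom, ← tensorHom_id, tensorHom_comp_tensorHom, Category.id_comp,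
      tensorHom_comp_tensorHom_assoc, Category.comp_id, id_tensorHom_id]

theorem zigzag_factor' {X Y X₁ Y₁ X₂ Y₂ : C} (n : 𝟙_ C ⟶ X₁ ⊗ Y₁)
    (e : Y₂ ⊗ X₂ ⟶ 𝟙_ C) (a : X₁ ⟶ X) (b : Y₁ ⟶ Y) (c : X ⟶ X₂) (d : Y ⟶ Y₂) :
    (n ≫ (a ⊗ₘ b)) ▷ X ≫ (α_ _ _ _).hom ≫ X ◁ ((d ⊗ₘ c) ≫ e) =
      _ ◁ c ≫ (n ≫ (X₁ ◁ (b ≫ d))) ▷ X₂ ≫ (α_ _ _ _).hom ≫ X₁ ◁ e ≫ a ▷ _ := by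
  have h1 : (a ⊗ₘ ((b ≫ d) ⊗ₘ c)) = (a ⊗ₘ (b ⊗ₘ 𝟙 X)) ≫ (𝟙 X ⊗ₘ (d ⊗ₘ c)) := by
    simp only [tensorHom_comp_tensorHom, Category.id_comp, Category.comp_id]
  have h2 : (a ⊗ₘ ((b ≫ d) ⊗ₘ c)) =
      (𝟙 X₁ ⊗ₘ ((b ≫ d) ⊗ₘ c)) ≫ (a ⊗ₘ (𝟙 _ ⊗ₘ 𝟙 _)) := by
    simp only [tensorHom_comp_tensorHom, Category.id_comp, Category.comp_id]
  have h3 := associator_naturality a b (𝟙 X)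
  have h4 := associator_naturality (𝟙 X₁) (b ≫ d) c
  trans n ▷ X ≫ (α_ _ _ _).hom ≫ (a ⊗ₘ ((b ≫ d) ⊗ₘ c)) ≫ X ◁ e
  · rw [h1, Category.assoc, ← reassoc_of% h3]
    simp only [← id_tensorHom, ← tensorHom_id, tensorHom_comp_tensorHom, Category.id_comp,
      tensorHom_comp_tensorHom_assoc]
  · rw [h2, Category.assoc, ← reassoc_of% h4]
    simp only [← id_tensorHom, ← tensorHom_id, tensorHom_comp_tensorHom, Category.id_comp,
      tensorHom_comp_tensorHom_assoc, Category.comp_id, id_tensorHom_id]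

variable [Preadditive C] [MonoidalPreadditive C]

theorem tensorHom_zero_left {W X Y Z : C} (f : W ⟶ X) : (0 : Y ⟶ Z) ⊗ₘ f = 0 := by
  rw [MonoidalCategory.tensorHom_def, MonoidalPreadditive.zero_whiskerRight, zero_comp]

theorem tensorHom_zero_right {W X Y Z : C} (f : W ⟶ X) : f ⊗ₘ (0 : Y ⟶ Z) = 0 := by
  rw [MonoidalCategory.tensorHom_def, MonoidalPreadditive.whiskerLeft_zero, comp_zero]

variable [HasFiniteBiproducts C]

omit [MonoidalCategory C] [MonoidalPreadditive C] in
theorem sum_comp_π_ι_comp {J : Type*} [Fintype J] (Y : J → C) {W Z : C} (f : W ⟶ ⨁ Y)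
    (g : ⨁ Y ⟶ Z) : ∑ j, f ≫ (biproduct.π Y j ≫ biproduct.ι Y j) ≫ g = f ≫ g := by
  classical
  have h : ∑ j, biproduct.π Y j ≫ biproduct.ι Y j = 𝟙 (⨁ Y) := by
    refine biproduct.hom_ext' _ _ fun i => ?_
    rw [Preadditive.comp_sum, Finset.sum_eq_single i]
    · simp
    · intro j _ hj
      rw [biproduct.ι_π_ne_assoc _ hj.symm, zero_comp]
    · simp
  rw [← Preadditive.comp_sum, ← Preadditive.sum_comp, h, Category.id_comp]

/-- The diagonal pairing of two finite direct sums. -/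
noncomputable def biproductPairing {J : Type*} [Fintype J] {X Y : J → C} (e : ∀ j, Y j ⊗ X j ⟶ 𝟙_ C) :
    (⨁ Y) ⊗ (⨁ X) ⟶ 𝟙_ C :=
  ∑ j, (biproduct.π Y j ⊗ₘ biproduct.π X j) ≫ e j

theorem ι_biproductPairing_self {J : Type*} [Fintype J] {X Y : J → C}
    (e : ∀ j, Y j ⊗ X j ⟶ 𝟙_ C) (j : J) :
    (biproduct.ι Y j ⊗ₘ biproduct.ι X j) ≫ biproductPairing e = e j := by
  classical
  rw [biproductPairing, Preadditive.comp_sum, Finset.sum_eq_single j]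
  · rw [tensorHom_comp_tensorHom_assoc]; simp
  · intro l _ hl
    rw [tensorHom_comp_tensorHom_assoc, biproduct.ι_π_ne _ hl.symm, tensorHom_zero_left, zero_comp]
  · simp

theorem ι_biproductPairing_of_ne {J : Type*} [Fintype J] {X Y : J → C}
    (e : ∀ j, Y j ⊗ X j ⟶ 𝟙_ C) {i j : J} (h : i ≠ j) :
    (biproduct.ι Y i ⊗ₘ biproduct.ι X j) ≫ biproductPairing e = 0 := by
  classical
  rw [biproductPairing, Preadditive.comp_sum]
  refine Finset.sum_eq_zero fun l _ => ?_
  rw [tensorHom_comp_tensorHom_assoc]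
  by_cases hl : i = l
  · subst hl
    rw [biproduct.ι_π_ne _ h.symm, tensorHom_zero_right, zero_comp]
  · rw [biproduct.ι_π_ne _ hl, tensorHom_zero_left, zero_comp]

/-- Finite direct sums of exact pairings. -/
@[reducible]
noncomputable def biproductExactPairing {J : Type*} [Fintype J] (X Y : J → C)
    (p : ∀ j, ExactPairing (X j) (Y j)) : ExactPairing (⨁ X) (⨁ Y) where
  coevaluation' := ∑ j, (p j).coevaluation' ≫ (biproduct.ι X j ⊗ₘ biproduct.ι Y j)
  evaluation' := biproductPairing fun j => (p j).evaluation'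
  coevaluation_evaluation' := by
    classical
    have key : ∀ j l, (⨁ Y) ◁ ((p j).coevaluation' ≫ (biproduct.ι X j ⊗ₘ biproduct.ι Y j)) ≫
        (α_ _ _ _).inv ≫ ((biproduct.π Y l ⊗ₘ biproduct.π X l) ≫ (p l).evaluation') ▷ (⨁ Y) =
        if j = l then (ρ_ _).hom ≫ (biproduct.π Y j ≫ biproduct.ι Y j) ≫ (λ_ _).inv else 0 := by
      intro j l
      rw [zigzag_factor]
      split_ifs with h
      · subst h
        have h2 := (p j).coevaluation_evaluation'
        rw [biproduct.ι_π_self, id_whiskerRight, Category.comp_id, reassoc_of% h2]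
        simp
      · rw [biproduct.ι_π_ne _ h]
        simp
    simp only [biproductPairing, whiskerLeft_sum, sum_whiskerRight, Preadditive.sum_comp,
      Preadditive.comp_sum, key, Finset.sum_ite_eq', Finset.mem_univ, if_true,
      sum_comp_π_ι_comp]
  evaluation_coevaluation' := by
    classical
    have key : ∀ j l, ((p j).coevaluation' ≫ (biproduct.ι X j ⊗ₘ biproduct.ι Y j)) ▷ (⨁ X) ≫
        (α_ _ _ _).hom ≫ (⨁ X) ◁ ((biproduct.π Y l ⊗ₘ biproduct.π X l) ≫ (p l).evaluation') =
        if j = l then (λ_ _).hom ≫ (biproduct.π X j ≫ biproduct.ι X j) ≫ (ρ_ _).inv else 0 := by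
      intro j l
      rw [zigzag_factor']
      split_ifs with h
      · subst h
        have h2 := (p j).evaluation_coevaluation'
        rw [biproduct.ι_π_self, MonoidalCategory.whiskerLeft_id, Category.comp_id,
          reassoc_of% h2]
        simp
      · rw [biproduct.ι_π_ne _ h]
        simp
    simp only [biproductPairing, whiskerLeft_sum, sum_whiskerRight, Preadditive.sum_comp,
      Preadditive.comp_sum, key, Finset.sum_ite_eq', Finset.mem_univ, if_true,
      sum_comp_π_ι_comp]

end ExactPairings

end Equivariantization

namespace Equivariantization

open Functor.LaxMonoidal Functor.OplaxMonoidal Functor.Monoidal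

variable {k : Type*} [Field k] {G : Type*} [Group G] {C : Type u} [Category.{v} C]

/-! ### Pairings under monoidal functors, and duals in the equivariantization -/

section Tensor

variable [MonoidalCategory C]

theorem tensor_evaluation_cancel {X Y W Z : C} [ExactPairing X Y] {f g : Z ⟶ Y} {i : W ⟶ X}
    [IsIso i] (h : (f ⊗ₘ i) ≫ ε_ X Y = (g ⊗ₘ i) ≫ ε_ X Y) : f = g := by
  refine whiskerRight_evaluation_cancel (X := X) ?_
  rw [tensorHom_def', tensorHom_def', Category.assoc, Category.assoc] at h
  exact (cancel_epi (Z ◁ i)).1 h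

variable [Preadditive C] [Linear k C] [MonoidalPreadditive C] [MonoidalLinear k C]

theorem smul_tensorHom_smul {X X' Y Y' : C} (r s : k) (f : X ⟶ X') (g : Y ⟶ Y') :
    ((r • f) ⊗ₘ (s • g)) = (r * s) • (f ⊗ₘ g) := by
  rw [MonoidalCategory.tensorHom_def, MonoidalCategory.tensorHom_def,
    MonoidalLinear.smul_whiskerRight, MonoidalLinear.whiskerLeft_smul, Linear.smul_comp,
    Linear.comp_smul, smul_smul]

end Tensor

section MapPairing

variable [MonoidalCategory C]

/-- The image `F(Y) ⊗ F(X) ⟶ 1` of a pairing `Y ⊗ X ⟶ 1` under a monoidal functor. -/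
def mapPairing (F : C ⥤ C) [F.Monoidal] {X Y : C} (e : Y ⊗ X ⟶ 𝟙_ C) :
    F.obj Y ⊗ F.obj X ⟶ 𝟙_ C :=
  μ F Y X ≫ F.map e ≫ η F

theorem map_tensor_mapPairing (F : C ⥤ C) [F.Monoidal] {X Y X' Y' : C} (f : Y' ⟶ Y)
    (g : X' ⟶ X) (e : Y ⊗ X ⟶ 𝟙_ C) :
    (F.map f ⊗ₘ F.map g) ≫ mapPairing F e = mapPairing F ((f ⊗ₘ g) ≫ e) := by
  simp [mapPairing]

theorem δ_mapPairing (F : C ⥤ C) [F.Monoidal] {X Y : C} (e : Y ⊗ X ⟶ 𝟙_ C) :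
    δ F Y X ≫ mapPairing F e = F.map e ≫ η F := by
  simp [mapPairing]

theorem mapPairing_smul [Preadditive C] [Linear k C] (F : C ⥤ C) [F.Monoidal] [F.Linear k]
    {X Y : C} (r : k) (e : Y ⊗ X ⟶ 𝟙_ C) : mapPairing F (r • e) = r • mapPairing F e := by
  simp [mapPairing, F.map_smul]

theorem mapPairing_zero [Preadditive C] (F : C ⥤ C) [F.Monoidal] [F.Additive]
    {X Y : C} : mapPairing F (0 : Y ⊗ X ⟶ 𝟙_ C) = 0 := by
  simp [mapPairing]

variable [Preadditive C] [Linear k C]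

/-- Naturality of ρ₂ at `p` and its compatibility with δ and η give this identity preceded by the
isomorphisms δ, which cancel. -/
theorem comp_tensor_mapPairing (A : TensorAction k G C) {g h l : G} (e : g * h = l) {X Y : C}
    (p : Y ⊗ X ⟶ 𝟙_ C) :
    ((A.comp e).hom.app Y ⊗ₘ (A.comp e).hom.app X) ≫ mapPairing (A.F l) p =
      mapPairing (A.F g) (mapPairing (A.F h) p) := by
  have h1 := A.comp_δ e Y X
  have h2 := (A.comp e).hom.naturality p
  have h3 := A.comp_η e
  have h4 : (A.comp e).hom.app (Y ⊗ X) ≫ (A.F l).map p ≫ η (A.F l) =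
      (A.F g).map ((A.F h).map p ≫ η (A.F h)) ≫ η (A.F g) := by
    rw [← reassoc_of% h2, h3]; simp
  rw [← δ_mapPairing, reassoc_of% h1, ← δ_mapPairing, Functor.map_comp, Category.assoc,
    ← δ_mapPairing] at h4
  rwa [cancel_epi, cancel_epi] at h4

theorem comp_inv_tensor_mapPairing (A : TensorAction k G C) {g h l : G} (e : g * h = l) {X Y : C}
    (p : Y ⊗ X ⟶ 𝟙_ C) :
    ((A.comp e).inv.app Y ⊗ₘ (A.comp e).inv.app X) ≫
      mapPairing (A.F g) (mapPairing (A.F h) p) = mapPairing (A.F l) p := by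
  rw [← comp_tensor_mapPairing A e, tensorHom_comp_tensorHom_assoc]
  simp

end MapPairing

section EquivariantPairing

variable [Preadditive C] [Linear k C] [MonoidalCategory C] {A : TensorAction k G C}

/-- An exact pairing of the underlying objects whose evaluation is equivariant is an exact
pairing in the equivariantization. -/
@[reducible]
def equivariantExactPairing (M N : EquivObj A.toLinearAction) (p : ExactPairing M.X N.X)
    (h : ∀ g, (N.μ g ⊗ₘ M.μ g) ≫ p.evaluation' = mapPairing (A.F g) p.evaluation') :
    ExactPairing M N where
  evaluation' := ⟨p.evaluation', fun g => by
    change (δ (A.F g) _ _ ≫ (N.μ g ⊗ₘ M.μ g)) ≫ p.evaluation' = _ ≫ η (A.F g)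
    rw [Category.assoc, h]
    exact δ_mapPairing _ _⟩
  coevaluation' := ⟨p.coevaluation', fun g => by
    change η (A.F g) ≫ p.coevaluation' = _ ≫ δ (A.F g) _ _ ≫ (M.μ g ⊗ₘ N.μ g)
    have := M.isIso_μ g
    have := N.isIso_μ g
    -- Equivariance of the evaluation says that transporting the pairing along the isomorphisms μ^g
    -- and applying ρ^g to it give the same evaluation. The coevaluations then agree too, which is
    -- their equivariance.
    have h1 := coevaluation_eq_of_evaluation_eq
      (exactPairingCongr (asIso (M.μ g)) (asIso (N.μ g)))
      (mapExactPairing (A.F g) M.X N.X)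
      ((exactPairingCongr_evaluation _ _).trans (h g))
    rw [exactPairingCongr_coevaluation] at h1
    have h2 : p.coevaluation' ≫ (inv (M.μ g) ⊗ₘ inv (N.μ g)) =
      ε (A.F g) ≫ (A.F g).map p.coevaluation' ≫ δ (A.F g) M.X N.X := h1
    have h3 := congrArg (fun t => η (A.F g) ≫ t ≫ (M.μ g ⊗ₘ N.μ g)) h2
    simp only [Category.assoc, tensorHom_comp_tensorHom, IsIso.inv_hom_id, id_tensorHom_id,
      Category.comp_id, η_ε_assoc] at h3
    exact h3⟩
  coevaluation_evaluation' := EquivObj.hom_ext p.coevaluation_evaluation'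
  evaluation_coevaluation' := EquivObj.hom_ext p.evaluation_coevaluation'

variable [RightRigidCategory C]

theorem dualFamily_pairing (A : TensorAction k G C) {H : Subgroup G} {Y : C} (c : ∀ h : H, (A.F h).obj Y ≅ Y) (h : H) :
    ((dualFamily A c h).hom ⊗ₘ (c h).hom) ≫ ε_ Y Yᘁ = mapPairing (A.F h) (ε_ Y Yᘁ) :=
  dualFamily_evaluation A c h

end EquivariantPairing

/-! ### The factor set of the dual family -/

section DualFamily

variable [Abelian C] [Linear k C] [MonoidalCategory C] [MonoidalPreadditive C] [MonoidalLinear k C]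
  [RightRigidCategory C] {A : TensorAction k G C}

/-- The factor set of the dual family is the inverse of that of the family. -/
theorem isFactorSet_dualFamily {H : Subgroup G} {Y : C} {c : ∀ h : H, (A.F h).obj Y ≅ Y}
    {α : H → H → kˣ} (hα : IsFactorSet A.toLinearAction c α) :
    IsFactorSet A.toLinearAction (dualFamily A c) fun g h => (α g h)⁻¹ := by
  intro g h
  rw [inv_inv]
  have hc := hα g h
  have hd := dualFamily_pairing A c g
  have hd' := dualFamily_pairing A c h
  have hd'' := dualFamily_pairing A c (g * h)
  -- Both sides are tensored with the same isomorphism ρ^g ρ^h Y → Y and evaluated. On the right its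
  -- factor-set identity contributes α⁻¹, cancelling α; both results are the image of the evaluation
  -- under ρ^g ρ^h.
  refine tensor_evaluation_cancel (X := Y) (i := (A.F g).map (c h).hom ≫ (c g).hom) ?_
  trans mapPairing (A.F g) (mapPairing (A.F h) (ε_ Y Yᘁ))
  · rw [← tensorHom_comp_tensorHom, Category.assoc, hd, map_tensor_mapPairing, hd']
  · rw [hc, smul_tensorHom_smul, Units.mul_inv, one_smul, ← tensorHom_comp_tensorHom,
      Category.assoc, hd'']
    exact (comp_tensor_mapPairing A _ _).symm

end DualFamily

/-! ### Inertia group and simplicity of the dual object -/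

section Dual

variable [MonoidalCategory C] [RigidCategory C]

/-- As ρ^g is monoidal, ρ^g(Y^*) is a dual of ρ^g(Y); duals are unique up to isomorphism, on either
side. -/
theorem inertia_rightDual [Preadditive C] [Linear k C] (A : TensorAction k G C) (Y : C) :
    A.inertia Yᘁ = A.inertia Y := by
  ext g
  refine ⟨?_, ?_⟩
  · rintro ⟨i⟩
    exact ⟨leftDualIso (letI := mapExactPairing (A.F g) Y Yᘁ; exactPairingCongrRight i.symm)
      HasRightDual.exact⟩
  · rintro ⟨i⟩
    exact ⟨rightDualIso (letI := mapExactPairing (A.F g) Y Yᘁ; exactPairingCongrLeft i.symm)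
      HasRightDual.exact⟩

/-- A nonzero monomorphism `f : Z ⟶ Yᘁ` has a mate `g : Y ⟶ ᘁZ`, which is nonzero, hence mono
because `Y` is simple. It is epi because tensoring with a fixed object preserves monomorphisms. So
`g` is invertible, and with it `f`. -/
theorem simple_rightDual [Abelian C] [MonoidalPreadditive C] (Y : C) [Simple Y] : Simple Yᘁ := by
  have main : ∀ {Z : C} (f : Z ⟶ Yᘁ) [Mono f], f ≠ 0 → IsIso f := by
    intro Z f _ hf
    let _ : HasLeftDual Yᘁ := ⟨Y⟩
    let g : Y ⟶ (ᘁZ) := leftAdjointMate f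
    have hg : Z ◁ g ≫ ε_ (ᘁZ) Z = f ▷ Y ≫ ε_ Y Yᘁ := leftAdjointMate_comp_evaluation f
    have hg' : η_ Y Yᘁ ≫ g ▷ Yᘁ = η_ (ᘁZ) Z ≫ (ᘁZ) ◁ f := coevaluation_comp_leftAdjointMate f
    have hg0 : g ≠ 0 := by
      intro h0
      apply hf
      refine whiskerRight_evaluation_cancel (X := Y) ?_
      rw [← hg, h0]
      simp
    have : Mono g := mono_of_nonzero_from_simple hg0
    have : Epi g := by
      refine Preadditive.epi_of_cancel_zero _ fun {W} c hc => ?_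
      have : (tensorLeft W).PreservesMonomorphisms :=
        Functor.preservesMonomorphisms_of_adjunction (tensorLeftAdjunction W Wᘁ)
      have hm : Mono (W ◁ f) := inferInstanceAs (Mono ((tensorLeft W).map f))
      -- The transpose of `c` may be tested after the monomorphism `W ◁ f`; the mate relation then
      -- turns `f` into `g`, and `g ≫ c = 0`.
      have h1 : η_ (ᘁZ) Z ≫ c ▷ Z = 0 := by
        rw [← cancel_mono (W ◁ f), Category.assoc, ← whisker_exchange, ← reassoc_of% hg',
          ← comp_whiskerRight, hc]
        simp
      have h2 := tensorRightHomEquiv_symm_coevaluation_comp_whiskerRight (Y' := Z) c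
      rw [h1] at h2
      simpa [tensorRightHomEquiv] using h2.symm
    have : IsIso g := isIso_of_mono_of_epi g
    let p : ExactPairing Y Z := exactPairingCongrLeft (asIso g)
    -- Through `g`, the object `Z` is itself a right dual of `Y`, and `f` is the comparison of two
    -- right duals.
    have hp : (rightDualIso p (inferInstanceAs (ExactPairing Y Yᘁ))).hom = f := by
      refine whiskerRight_evaluation_cancel (X := Y) ?_
      have h2 := @rightAdjointMate_comp_evaluation C _ _ Y Y ⟨Yᘁ⟩ ⟨Z⟩ (𝟙 Y)
      rw [MonoidalCategory.whiskerLeft_id, Category.id_comp] at h2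
      exact h2.trans hg
    rw [← hp]
    infer_instance
  refine ⟨fun {Z} f _ => ⟨fun hi h0 => ?_, main f⟩⟩
  -- It remains to exclude `Yᘁ = 0`: the evaluation would vanish, and a triangle identity would
  -- force `𝟙 Y = 0`.
  have h1 : 𝟙 (Yᘁ : C) = 0 := (IsIso.inv_hom_id f).symm.trans (by simp [h0])
  have h2 := ExactPairing.evaluation_coevaluation Y Yᘁ
  have h3 : ε_ Y Yᘁ = 0 := by
    rw [← Category.id_comp (ε_ Y Yᘁ), ← id_whiskerRight, h1]
    simp
  rw [h3, MonoidalPreadditive.whiskerLeft_zero, comp_zero, comp_zero] at h2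
  have h4 : 𝟙 Y = (λ_ Y).inv ≫ ((λ_ Y).hom ≫ (ρ_ Y).inv) ≫ (ρ_ Y).hom := by simp
  rw [← h2] at h4
  exact id_nonzero Y (by simpa using h4)

end Dual

end Equivariantization

namespace Equivariantization

variable {k : Type*} [Field k] {G : Type*} [Group G] {C : Type u} [Category.{v} C]
  [Abelian C] [Linear k C]

/-! ### The pairing of V^* ⊗ Y' with V ⊗ Y -/

section BasisChange

variable {ι κ : Type} {W : Type*} [Fintype ι] [Fintype κ] [DecidableEq ι] [DecidableEq κ] [AddCommGroup W]
  [Module k W]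

/-- The change of basis `W ⊗ Y ⟶ W ⊗ Y` between the direct sums of copies of `Y` indexed by two
bases of `W`. -/
noncomputable def basisChange (b : Module.Basis ι k W) (b' : Module.Basis κ k W) (Y : C) :
    (⨁ fun _ : ι => Y) ⟶ ⨁ fun _ : κ => Y :=
  biproduct.matrix fun i j => b'.toMatrix b j i • 𝟙 Y

omit [DecidableEq ι] [DecidableEq κ] in
theorem ι_basisChange (b : Module.Basis ι k W) (b' : Module.Basis κ k W) (Y : C) (i : ι) :
    biproduct.ι (fun _ => Y) i ≫ basisChange b b' Y =
      ∑ j, b'.toMatrix b j i • biproduct.ι (fun _ : κ => Y) j := by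
  classical
  rw [basisChange, biproduct.ι_matrix, biproduct.lift_eq]
  simp

omit [DecidableEq κ] in
theorem basisChange_comp (b : Module.Basis ι k W) (b' : Module.Basis κ k W) (Y : C) :
    basisChange b b' Y ≫ basisChange b' b Y = 𝟙 _ := by
  refine biproduct.hom_ext' _ _ fun i => ?_
  rw [reassoc_of% ι_basisChange, Preadditive.sum_comp]
  simp only [Linear.smul_comp, ι_basisChange, Finset.smul_sum, smul_smul]
  rw [Finset.sum_comm]
  have h : ∀ l, ∑ j, b'.toMatrix b j i * b.toMatrix b' l j = (1 : Matrix ι ι k) l i := by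
    intro l
    rw [← b.toMatrix_mul_toMatrix_flip b', Matrix.mul_apply]
    exact Finset.sum_congr rfl fun _ _ => mul_comm _ _
  simp only [← Finset.sum_smul, h, Matrix.one_apply]
  simp

/-- `basisChange` as an isomorphism. -/
@[simps]
noncomputable def basisChangeIso (b : Module.Basis ι k W) (b' : Module.Basis κ k W) (Y : C) :
    (⨁ fun _ : ι => Y) ≅ ⨁ fun _ : κ => Y where
  hom := basisChange b b' Y
  inv := basisChange b' b Y
  hom_inv_id := basisChange_comp b b' Y
  inv_hom_id := basisChange_comp b' b Y

end BasisChange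

variable [MonoidalCategory C] [MonoidalPreadditive C]

/-- Tensoring with a fixed object is additive, so the extensionality for one direct sum applies in
each factor. -/
theorem tensor_map_biproduct_hom_ext {J J' : Type*} [Finite J] [Finite J'] (F : C ⥤ C) [F.Additive]
    {f : J → C} {f' : J' → C} {Z : C} {p q : F.obj (⨁ f) ⊗ F.obj (⨁ f') ⟶ Z}
    (h : ∀ i j, (F.map (biproduct.ι f i) ⊗ₘ F.map (biproduct.ι f' j)) ≫ p =
      (F.map (biproduct.ι f i) ⊗ₘ F.map (biproduct.ι f' j)) ≫ q) : p = q := by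
  refine map_biproduct_hom_ext (F ⋙ tensorRight (F.obj (⨁ f'))) (f := f) fun i => ?_
  refine map_biproduct_hom_ext (F ⋙ tensorLeft (F.obj (f i))) (f := f') fun j => ?_
  have h1 := h i j
  rw [tensorHom_def', Category.assoc, Category.assoc] at h1
  exact h1

variable [MonoidalLinear k C]

section VecPairing

variable {V : Type*} [AddCommGroup V] [Module k V] [FiniteDimensional k V]

/-- The exact pairing of `V ⊗ Y` and `V^* ⊗ Y'` for an exact pairing of `Y` and `Y'`. -/
@[reducible]
noncomputable def vecExactPairing (k : Type*) [Field k] [Linear k C] [MonoidalLinear k C]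
    (V : Type*) [AddCommGroup V] [Module k V] [FiniteDimensional k V] (Y Y' : C)
    [p : ExactPairing Y Y'] : ExactPairing (vecObj k V Y) (vecObj k (Module.Dual k V) Y') :=
  letI := biproductExactPairing (fun _ : Fin (Module.finrank k V) => Y) (fun _ => Y') fun _ => p
  -- The copies of `Y'` are indexed by a chosen basis of V^* that need not be dual to the chosen
  -- basis of V. The diagonal pairing is the canonical one only for dual bases, hence the change of
  -- basis.
  exactPairingCongrRight
    (basisChangeIso (Module.finBasis k (Module.Dual k V)) (Module.finBasis k V).dualBasis Y')

theorem ι_vecExactPairing_evaluation (Y Y' : C) [ExactPairing Y Y']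
    (i : Fin (Module.finrank k (Module.Dual k V))) (j : Fin (Module.finrank k V)) :
    (biproduct.ι (fun _ => Y') i ⊗ₘ biproduct.ι (fun _ => Y) j) ≫
        (vecExactPairing k V Y Y').evaluation' =
      Module.finBasis k (Module.Dual k V) i (Module.finBasis k V j) • ε_ Y Y' := by
  change _ ≫ basisChange _ _ Y' ▷ _ ≫ biproductPairing (fun _ => ε_ Y Y') = _
  rw [← tensorHom_id, tensorHom_comp_tensorHom_assoc, ι_basisChange, Category.comp_id, sum_tensor,
    Preadditive.sum_comp, Finset.sum_eq_single j]
  · rw [← one_smul k (biproduct.ι (fun _ => Y) j), smul_tensorHom_smul, mul_one, Linear.smul_comp,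
      ι_biproductPairing_self]
    simp [Module.Basis.toMatrix_apply]
  · intro l _ hl
    rw [← one_smul k (biproduct.ι (fun _ => Y) j), smul_tensorHom_smul, mul_one, Linear.smul_comp,
      ι_biproductPairing_of_ne _ hl, smul_zero]
  · simp

/-- This is (π^*(h) f)(π(h) v) = f(v) in coordinates. -/
theorem sum_toMatrix_mul_dual {H : Type*} [Group H] {α : H → H → kˣ} (π : ProjRep α V) (h : H)
    (i : Fin (Module.finrank k (Module.Dual k V))) (j : Fin (Module.finrank k V)) :
    ∑ i', ∑ j', LinearMap.toMatrix (Module.finBasis k (Module.Dual k V))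
        (Module.finBasis k (Module.Dual k V)) (π.dual.toFun h).toLinearMap i' i *
      LinearMap.toMatrix (Module.finBasis k V) (Module.finBasis k V)
        (π.toFun h).toLinearMap j' j *
      Module.finBasis k (Module.Dual k V) i' (Module.finBasis k V j') =
    Module.finBasis k (Module.Dual k V) i (Module.finBasis k V j) := by
  have h1 := (Module.finBasis k (Module.Dual k V)).sum_repr
    (π.dual.toFun h (Module.finBasis k (Module.Dual k V) i))
  have h2 := (Module.finBasis k V).sum_repr (π.toFun h (Module.finBasis k V j))
  have h3 : (π.dual.toFun h (Module.finBasis k (Module.Dual k V) i))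
      (π.toFun h (Module.finBasis k V j)) =
      Module.finBasis k (Module.Dual k V) i (Module.finBasis k V j) := by
    simp [ProjRep.dual, LinearEquiv.dualMap_apply]
  rw [← h3]
  conv_rhs => rw [← h1, ← h2]
  simp only [LinearMap.toMatrix_apply, LinearMap.sum_apply, map_sum, LinearMap.smul_apply,
    map_smul, smul_eq_mul, LinearEquiv.coe_coe, Finset.mul_sum]
  rw [Finset.sum_comm]
  refine Finset.sum_congr rfl fun _ _ => Finset.sum_congr rfl fun _ _ => ?_
  ring

/-- The pairing of `V^* ⊗ Y'` and `V ⊗ Y` is equivariant if that of `Y'` and `Y` is. -/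
theorem vecStr_pairing (A : TensorAction k G C) {H : Subgroup G} {Y Y' : C} [ExactPairing Y Y']
    (c : ∀ h : H, (A.F h).obj Y ≅ Y) (d : ∀ h : H, (A.F h).obj Y' ≅ Y') {α : H → H → kˣ}
    (π : ProjRep α V) (h : H)
    (hcd : ((d h).hom ⊗ₘ (c h).hom) ≫ ε_ Y Y' = mapPairing (A.F h) (ε_ Y Y')) :
    (vecStr A.toLinearAction d π.dual h ⊗ₘ vecStr A.toLinearAction c π h) ≫
        (vecExactPairing k V Y Y').evaluation' =
      mapPairing (A.F h) (vecExactPairing k V Y Y').evaluation' := by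
  refine tensor_map_biproduct_hom_ext (A.F h) fun i j => ?_
  rw [tensorHom_comp_tensorHom_assoc, ι_vecStr, ι_vecStr, map_tensor_mapPairing,
    ι_vecExactPairing_evaluation, mapPairing_smul, sum_tensor, Preadditive.sum_comp,
    ← sum_toMatrix_mul_dual π h i j, Finset.sum_smul]
  refine Finset.sum_congr rfl fun i' _ => ?_
  rw [tensor_sum, Preadditive.sum_comp, Finset.sum_smul]
  refine Finset.sum_congr rfl fun j' _ => ?_
  rw [smul_tensorHom_smul, ← tensorHom_comp_tensorHom, Linear.smul_comp, Category.assoc,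
    ι_vecExactPairing_evaluation, Linear.comp_smul, hcd, smul_smul]

end VecPairing

end Equivariantization

namespace Equivariantization

variable {k : Type*} [Field k] {G : Type*} [Group G] {C : Type u} [Category.{v} C]
  [Abelian C] [Linear k C]

/-! ### Independence of the induced object from the coset representatives -/

section Transition

variable {A : LinearAction k G C} {H : Subgroup G} (N : EquivObj (A.restrict H))

theorem exists_mul_eq {R : Set G} (hR : Subgroup.IsComplement R (H : Set G)) (g : G) :
    ∃ (s : R) (h : H), (s : G) * h = g :=
  let ⟨⟨s, h⟩, e⟩ := hR.2 g
  ⟨s, h, e⟩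

theorem indMap_congr {g t s : G} {h h' : H} (e : s * h = g * t) (hh : h' = h) :
    indMap N g t s h e = indMap N g t s h' (by rw [hh, e]) := by
  subst hh; rfl

theorem unit_comp_indMap {g t s : G} {h : H} (e : s * h = g * t) (e' : s * h = 1 * g * t) :
    A.unit.hom.app ((A.F g).obj ((A.F t).obj N.X)) ≫
      (A.comp (rfl : 1 * g = 1 * g)).hom.app ((A.F t).obj N.X) ≫ indMap N (1 * g) t s h e' =
      indMap N g t s h e := by
  -- The product `1 * g` is replaced by a variable so that its equality with `g` can be substituted
  -- in the functors.
  have key : ∀ (l : G) (h₁ : 1 * g = l) (h₂ : s * h = l * t),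
      A.unit.hom.app ((A.F g).obj ((A.F t).obj N.X)) ≫
      (A.comp h₁).hom.app ((A.F t).obj N.X) ≫ indMap N l t s h h₂ = indMap N g t s h e := by
    intro l h₁ h₂
    obtain rfl : g = l := by rw [← h₁, one_mul]
    have h3 := A.unit_left g ((A.F t).obj N.X)
    rw [reassoc_of% h3]
  exact key _ _ _

theorem map_unit_comp_indMap {g t s : G} {h : H} (e : s * h = g * t) (e' : s * h = g * 1 * t) :
    (A.F g).map (A.unit.hom.app ((A.F t).obj N.X)) ≫
      (A.comp (rfl : g * 1 = g * 1)).hom.app ((A.F t).obj N.X) ≫ indMap N (g * 1) t s h e' =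
      indMap N g t s h e := by
  have key : ∀ (l : G) (h₁ : g * 1 = l) (h₂ : s * h = l * t),
      (A.F g).map (A.unit.hom.app ((A.F t).obj N.X)) ≫
      (A.comp h₁).hom.app ((A.F t).obj N.X) ≫ indMap N l t s h h₂ = indMap N g t s h e := by
    intro l h₁ h₂
    obtain rfl : g = l := by rw [← h₁, mul_one]
    have h3 := A.unit_right g ((A.F t).obj N.X)
    rw [reassoc_of% h3]
  exact key _ _ _

/-- For `s h = t`, the morphism `ρ^t(N) ⟶ ρ^s(N)` given by the equivariant structure. -/
def transition (t s : G) (h : H) (e : s * h = 1 * t) : (A.F t).obj N.X ⟶ (A.F s).obj N.X :=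
  A.unit.hom.app _ ≫ indMap N 1 t s h e

/-- A transition is ρ₀ followed by `indMap` for the identity of G, so this is the cocycle identity
`indMap_comp` with first element 1, the unit coherence of the action absorbing that factor. -/
theorem indMap_transition {g t s s' : G} {h h' : H} (e : s * h = g * t) (e' : s' * h' = 1 * s)
    (e'' : s' * (h' * h : H) = g * t) :
    indMap N g t s h e ≫ transition N s s' h' e' = indMap N g t s' (h' * h) e'' := by
  have h1 := A.unit.hom.naturality (indMap N g t s h e)
  simp only [Functor.id_map] at h1
  rw [transition, reassoc_of% h1, indMap_comp N 1 g t s s' h h' e e' (by rw [e'', one_mul])]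
  exact unit_comp_indMap N e'' _

theorem map_transition_indMap {g t s s' : G} {h h' : H} (e : s * h = 1 * t) (e' : s' * h' = g * s)
    (e'' : s' * (h' * h : H) = g * t) :
    (A.F g).map (transition N t s h e) ≫ indMap N g s s' h' e' =
      indMap N g t s' (h' * h) e'' := by
  rw [transition, Functor.map_comp, Category.assoc,
    indMap_comp N g 1 t s s' h h' e e' (by rw [e'', mul_one])]
  exact map_unit_comp_indMap N e'' _

variable [Finite G]

/-- The comparison of the objects induced with respect to two sets of representatives. -/
noncomputable def inducedComparison {R R' : Set G} (_hR : Subgroup.IsComplement R (H : Set G))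
    (hR' : Subgroup.IsComplement R' (H : Set G)) :
    (⨁ fun t : R => (A.F t).obj N.X) ⟶ ⨁ fun t : R' => (A.F t).obj N.X :=
  biproduct.desc fun t : R =>
    transition N t (hR'.equiv (1 * t)).1 (hR'.equiv (1 * t)).2 (hR'.equiv_fst_mul_equiv_snd _) ≫
      biproduct.ι (fun t : R' => (A.F t).obj N.X) (hR'.equiv (1 * t)).1

theorem ι_inducedComparison {R R' : Set G} (hR : Subgroup.IsComplement R (H : Set G))
    (hR' : Subgroup.IsComplement R' (H : Set G)) (t : R) (s : R') (h : H)
    (e : (s : G) * h = 1 * t) :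
    biproduct.ι (fun t : R => (A.F t).obj N.X) t ≫ inducedComparison N hR hR' =
      transition N t s h e ≫ biproduct.ι (fun t : R' => (A.F t).obj N.X) s := by
  have he : hR'.equiv (1 * t) = (s, h) := by
    rw [← Equiv.eq_symm_apply]
    exact e.symm
  obtain ⟨h1, h2⟩ := Prod.ext_iff.1 he
  dsimp only at h1 h2
  subst h1 h2
  exact biproduct.ι_desc _ _

theorem inducedComparison_comp {R R' : Set G} (hR : Subgroup.IsComplement R (H : Set G))
    (hR' : Subgroup.IsComplement R' (H : Set G)) :
    inducedComparison N hR hR' ≫ inducedComparison N hR' hR = 𝟙 _ := by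
  refine biproduct.hom_ext' _ _ fun t => ?_
  obtain ⟨s, h, hs⟩ := exists_mul_eq hR' (1 * t)
  have e2 : (t : G) * (h⁻¹ : H) = 1 * s := by
    rw [one_mul] at hs ⊢
    rw [← hs]
    simp
  have e3 : (t : G) * (h⁻¹ * h : H) = 1 * t := by simp
  rw [← Category.assoc, ι_inducedComparison N hR hR' t s h hs, Category.assoc,
    ι_inducedComparison N hR' hR s t _ e2, transition, Category.assoc,
    ← Category.assoc (indMap _ _ _ _ _ _), indMap_transition N hs e2 e3,
    indMap_congr N e3 (inv_mul_cancel _).symm, ← Category.assoc]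
  refine (congrArg (· ≫ _) (indMap_unit N t)).trans ?_
  simp

/-- Up to isomorphism, the induced object does not depend on the set of representatives. -/
noncomputable def inducedIso {R R' : Set G} (hR : Subgroup.IsComplement R (H : Set G))
    (hR' : Subgroup.IsComplement R' (H : Set G)) : induced N hR ≅ induced N hR' :=
  EquivObj.mkIso
    { hom := inducedComparison N hR hR'
      inv := inducedComparison N hR' hR
      hom_inv_id := inducedComparison_comp N hR hR'
      inv_hom_id := inducedComparison_comp N hR' hR } fun g => by
    refine map_biproduct_hom_ext (A.F g) fun t => ?_
    change _ ≫ indStr N hR g ≫ inducedComparison N hR hR' =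
      _ ≫ (A.F g).map (inducedComparison N hR hR') ≫ indStr N hR' g
    -- With g t = s h, s = s' h' and t = r l, both routes lead from ρ^g ρ^t to ρ^{s'}. One carries
    -- the element h' h, the other (h' h l⁻¹) l, which is the same.
    obtain ⟨s, h, hs⟩ := exists_mul_eq hR (g * t)
    obtain ⟨s', h', hs'⟩ := exists_mul_eq hR' (1 * s)
    obtain ⟨r, l, hr⟩ := exists_mul_eq hR' (1 * t)
    have e1 : (s' : G) * (h' * h : H) = g * t := by
      rw [Subgroup.coe_mul, ← mul_assoc, hs', one_mul, hs]
    have e2 : (s' : G) * (h' * h * l⁻¹ : H) = g * r := by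
      rw [one_mul] at hr
      rw [Subgroup.coe_mul, ← mul_assoc, e1, ← hr]
      simp [mul_assoc]
    have e3 : (s' : G) * (h' * h * l⁻¹ * l : H) = g * t := by
      rw [inv_mul_cancel_right, e1]
    rw [← Category.assoc, ι_indStr N hR g t s h hs, Category.assoc,
      ι_inducedComparison N hR hR' s s' h' hs', ← Category.assoc, indMap_transition N hs hs' e1,
      ← Functor.map_comp_assoc, ι_inducedComparison N hR hR' t r l hr, Functor.map_comp,
      Category.assoc, ι_indStr N hR' g r s' _ e2, ← Category.assoc,
      map_transition_indMap N hr e2 e3, indMap_congr N e3 (inv_mul_cancel_right _ _).symm]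

end Transition

/-! ### Induction preserves duality -/

section InducedPairing

variable [MonoidalCategory C] {A : TensorAction k G C}
  {H : Subgroup G} {N N' : EquivObj (A.toLinearAction.restrict H)} [p : ExactPairing N.X N'.X]

/-- Each of the three factors of `indMap` respects the pairings: ρ₂ and its inverse because they are
monoidal, ρ^s(ν^h) by the hypothesis on ν. -/
theorem indMap_pairing
    (hp : ∀ h : H, (resμ N' h ⊗ₘ resμ N h) ≫ ε_ N.X N'.X = mapPairing (A.F h) (ε_ N.X N'.X))
    {g t s : G} {h : H} (e : s * h = g * t) :
    (indMap N' g t s h e ⊗ₘ indMap N g t s h e) ≫ mapPairing (A.F s) (ε_ N.X N'.X) =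
      mapPairing (A.F g) (mapPairing (A.F t) (ε_ N.X N'.X)) := by
  rw [indMap, indMap, ← tensorHom_comp_tensorHom, ← tensorHom_comp_tensorHom, Category.assoc,
    Category.assoc, map_tensor_mapPairing, hp, comp_inv_tensor_mapPairing, comp_tensor_mapPairing]

/-- Induction preserves duality. -/
theorem nonempty_exactPairing_induced [MonoidalPreadditive C] [MonoidalLinear k C] [Finite G] {R R' : Set G}
    (hR : Subgroup.IsComplement R (H : Set G)) (hR' : Subgroup.IsComplement R' (H : Set G))
    (hp : ∀ h : H, (resμ N' h ⊗ₘ resμ N h) ≫ ε_ N.X N'.X = mapPairing (A.F h) (ε_ N.X N'.X)) :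
    Nonempty (ExactPairing (induced N hR : EquivObj A.toLinearAction) (induced N' hR')) := by
  have := Fintype.ofFinite R
  let q : ∀ t : R, ExactPairing ((A.F t).obj N.X) ((A.F t).obj N'.X) :=
    fun t => mapExactPairing (A.F t) N.X N'.X
  have hq : ∀ t, (q t).evaluation' = mapPairing (A.F t) (ε_ N.X N'.X) := fun _ => rfl
  let P : ExactPairing (induced N hR : EquivObj A.toLinearAction) (induced N' hR) := by
    refine equivariantExactPairing _ _
      (biproductExactPairing (fun t : R => (A.F t).obj N.X) (fun t : R => (A.F t).obj N'.X) q)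
      fun g => ?_
    refine tensor_map_biproduct_hom_ext (A.F g) fun i j => ?_
    change _ ≫ (indStr N' hR g ⊗ₘ indStr N hR g) ≫ biproductPairing _ =
      _ ≫ mapPairing (A.F g) (biproductPairing _)
    obtain ⟨s, h, hs⟩ := exists_mul_eq hR (g * i)
    obtain ⟨s', h', hs'⟩ := exists_mul_eq hR (g * j)
    rw [tensorHom_comp_tensorHom_assoc, ι_indStr N' hR g i s h hs, ι_indStr N hR g j s' h' hs',
      ← tensorHom_comp_tensorHom, Category.assoc, map_tensor_mapPairing]
    -- Left multiplication by g permutes the cosets of H: equal indices go to the same coset with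
    -- the same element of H, different indices to different cosets, where the diagonal pairing
    -- vanishes.
    by_cases hij : i = j
    · subst hij
      have h2 : ((s, h) : R × H) = (s', h') :=
        hR.1 (by simp only; rw [hs, hs'])
      obtain ⟨rfl, rfl⟩ := Prod.ext_iff.1 h2
      rw [ι_biproductPairing_self, ι_biproductPairing_self, hq, hq]
      exact indMap_pairing hp hs
    · have hss : s ≠ s' := by
        rintro rfl
        apply hij
        have h1 : (i : G) * (h⁻¹ * h' : H) = (j : G) * (1 : H) := by
          have e1 : (i : G) = g⁻¹ * (s * h) := by rw [hs]; simp
          have e2 : (j : G) = g⁻¹ * (s * h') := by rw [hs']; simp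
          rw [e1, e2]
          simp [mul_assoc]
        have h2 : ((i, h⁻¹ * h') : R × H) = (j, 1) := hR.1 h1
        exact (Prod.ext_iff.1 h2).1
      rw [ι_biproductPairing_of_ne _ hij, ι_biproductPairing_of_ne _ hss, mapPairing_zero,
        comp_zero]
  exact ⟨exactPairingCongrRight (inducedIso N' hR' hR)⟩

end InducedPairing

end Equivariantization

namespace Equivariantization

/-! ### Dual and rescaled projective representations -/

section ProjRep

variable {k : Type*} [Field k] {H : Type*} [Group H] {α : H → H → kˣ} {V : Type*}
  [AddCommGroup V] [Module k V]

/-- The common kernel in V of an invariant subspace of V^* is invariant, hence 0 or V. In finite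
dimension the subspace is recovered as its annihilator. -/
theorem ProjRep.Irreducible.dual [FiniteDimensional k V] {π : ProjRep α V}
    (hπ : π.Irreducible) : π.dual.Irreducible := by
  have := hπ.1
  refine ⟨inferInstance, fun U hU => ?_⟩
  have hinv : ∀ h, ∀ v ∈ U.dualCoannihilator, (π.toFun h).symm v ∈ U.dualCoannihilator := by
    intro h v hv
    rw [Submodule.mem_dualCoannihilator] at hv ⊢
    exact fun f hf => hv _ (hU h f hf)
  have hinv' : ∀ h, ∀ v ∈ U.dualCoannihilator, π.toFun h v ∈ U.dualCoannihilator := by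
    intro h v hv
    -- Stability under the inverse of π(h) becomes stability under π(h) by comparing dimensions.
    have hmap : U.dualCoannihilator.map (π.toFun h).symm.toLinearMap = U.dualCoannihilator :=
      Submodule.eq_of_le_of_finrank_eq (Submodule.map_le_iff_le_comap.2 (hinv h))
        (LinearEquiv.finrank_map_eq _ _)
    rw [← hmap] at hv
    obtain ⟨w, hw, rfl⟩ := hv
    simpa using hw
  have h3 : U.dualCoannihilator.dualAnnihilator = U :=
    Subspace.dualCoannihilator_dualAnnihilator_eq
  rcases hπ.2 _ hinv' with h | h
  · right; rw [← h3, h, Submodule.dualAnnihilator_bot]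
  · left; rw [← h3, h, Submodule.dualAnnihilator_top]

/-- Rescaling a projective representation by a map to the units of the field. -/
def ProjRep.rescale (π : ProjRep α V) (f : H → kˣ) (β : H → H → kˣ)
    (hβ : ∀ g h, β g h * f (g * h) = f g * f h * α g h) : ProjRep β V where
  toFun h := (π.toFun h).trans (LinearEquiv.smulOfUnit (f h))
  map_mul g h v := by
    have h1 := congrArg Units.val (hβ g h)
    simp only [Units.val_mul] at h1
    change (f g : k) • π.toFun g ((f h : k) • π.toFun h v) =
      (β g h : k) • (f (g * h) : k) • π.toFun (g * h) v
    rw [map_smul, π.map_mul, smul_smul, smul_smul, smul_smul, h1]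

end ProjRep

variable {k : Type*} [Field k] {G : Type*} [Group G] {C : Type u} [Category.{v} C]
  [Abelian C] [Linear k C]

theorem vecMap_smul_smul {V : Type*} [AddCommGroup V] [Module k V]
    [FiniteDimensional k V] (r s : k) (f : V →ₗ[k] V) {Y Z : C} (φ : Y ⟶ Z) :
    vecMap (r • f) (s • φ) = (r * s) • vecMap f φ := by
  refine biproduct.hom_ext' _ _ fun j => ?_
  rw [Linear.comp_smul, ι_vecMap, ι_vecMap, Finset.smul_sum]
  refine Finset.sum_congr rfl fun i _ => ?_
  rw [map_smul, Matrix.smul_apply, Linear.smul_comp, smul_smul, smul_smul, smul_eq_mul,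
    mul_right_comm]

/-- Two isomorphisms to a simple object differ by a scalar. -/
theorem exists_unit_smul_iso [IsAlgClosed k] {X Y : C} [Simple Y] [FiniteDimensional k (Y ⟶ Y)]
    (i j : X ≅ Y) : ∃ r : kˣ, j.hom = (r : k) • i.hom := by
  obtain ⟨r, hr⟩ := endomorphism_simple_eq_smul_id k (i.inv ≫ j.hom)
  have h1 : j.hom = r • i.hom := by
    rw [← Iso.hom_inv_id_assoc i j.hom, ← hr]
    simp
  refine ⟨Units.mk0 r ?_, h1⟩
  rintro rfl
  rw [zero_smul] at h1
  exact id_nonzero Y (by rw [← j.inv_hom_id, h1, comp_zero])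

/-- Replacing c by f c multiplies one side of the factor-set identity by f(g) f(h) and the other by
f(gh). The resulting relation is inverted to match the condition of `ProjRep.rescale` for the
scalars f⁻¹. -/
theorem IsFactorSet.mul_eq_of_smul {A : LinearAction k G C} {H : Subgroup G} {Y : C} [Simple Y]
    {c c' : ∀ h : H, (A.F h).obj Y ≅ Y} {α α' : H → H → kˣ} (hα : IsFactorSet A c α)
    (hα' : IsFactorSet A c' α') {f : H → kˣ} (hf : ∀ h, (c' h).hom = (f h : k) • (c h).hom)
    (g h : H) : α' g h * (f (g * h))⁻¹ = (f g)⁻¹ * (f h)⁻¹ * α g h := by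
  have h1 := hα' g h
  rw [hf, hf, hf, Functor.map_smul, Linear.smul_comp, Linear.comp_smul, hα g h,
    Linear.comp_smul, smul_smul, smul_smul, smul_smul] at h1
  let i := (A.comp (rfl : (g : G) * h = (g * h : H))).app Y ≪≫ c (g * h)
  -- Scalars can be compared because an isomorphism onto a simple object is nonzero.
  have h2 : ∀ r s : k, r • i.hom = s • i.hom → r = s := by
    intro r s hrs
    rw [← sub_eq_zero, ← sub_smul, smul_eq_zero] at hrs
    refine sub_eq_zero.1 (hrs.resolve_right fun h0 => id_nonzero Y ?_)
    rw [← i.inv_hom_id, h0, comp_zero]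
  have h3 : f h * f g * (α g h)⁻¹ = (α' g h)⁻¹ * f (g * h) := by
    ext
    exact h2 _ _ h1
  have h4 := congrArg (·⁻¹) h3
  simp only [mul_inv_rev, inv_inv] at h4
  rw [mul_comm, ← h4]
  simp only [mul_comm]

/-! ### Duality of the objects S and the proposition -/

section S

variable [MonoidalCategory C] [Finite G]

/-- The object `S_{Y',π^*}` is dual to `S_{Y,π}` if the families of isomorphisms are compatible
with the evaluation `Y' ⊗ Y ⟶ 1`. -/
theorem nonempty_exactPairing_S [MonoidalPreadditive C] [MonoidalLinear k C]
    (A : TensorAction k G C) {H : Subgroup G} {Y Y' : C} [ExactPairing Y Y'] {c : ∀ h : H, (A.F h).obj Y ≅ Y} {d : ∀ h : H, (A.F h).obj Y' ≅ Y'}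
    (hcd : ∀ h, ((d h).hom ⊗ₘ (c h).hom) ≫ ε_ Y Y' = mapPairing (A.F h) (ε_ Y Y'))
    {α : H → H → kˣ} (hα : IsFactorSet A.toLinearAction c α)
    (hd : IsFactorSet A.toLinearAction d fun g h => (α g h)⁻¹)
    {V : Type*} [AddCommGroup V] [Module k V] [FiniteDimensional k V] (π : ProjRep α V)
    {R R' : Set G} (hR : Subgroup.IsComplement R (H : Set G))
    (hR' : Subgroup.IsComplement R' (H : Set G)) :
    Nonempty (ExactPairing (S A c hα π hR) (S A d hd π.dual hR')) := by
  let _ : ExactPairing (vecEquivObj A.toLinearAction c hα π).X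
    (vecEquivObj A.toLinearAction d hd π.dual).X := vecExactPairing k V Y Y'
  exact nonempty_exactPairing_induced hR hR' fun h => vecStr_pairing A c d π h (hcd h)

/-- Rescaling the family of isomorphisms and the projective representation by inverse scalars
does not change `S_{Y,π}`. -/
theorem S_rescale (A : TensorAction k G C) {H : Subgroup G} {Y : C}
    {c c' : ∀ h : H, (A.F h).obj Y ≅ Y} {α α' : H → H → kˣ}
    (hα : IsFactorSet A.toLinearAction c α) (hα' : IsFactorSet A.toLinearAction c' α')
    {V : Type*} [AddCommGroup V] [Module k V] [FiniteDimensional k V] (π : ProjRep α V)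
    {f : H → kˣ} (hf : ∀ h, (c' h).hom = (f h : k) • (c h).hom)
    (hβ : ∀ g h, α' g h * (f (g * h))⁻¹ = (f g)⁻¹ * (f h)⁻¹ * α g h)
    {R : Set G} (hR : Subgroup.IsComplement R (H : Set G)) :
    S A c' hα' (π.rescale (fun h => (f h)⁻¹) α' hβ) hR = S A c hα π hR := by
  -- The underlying object depends only on V and Y, and the scalars cancel in each structure
  -- morphism; the result is an equality of objects, not merely an isomorphism.
  have h1 : vecStr A.toLinearAction c' (π.rescale (fun h => (f h)⁻¹) α' hβ) =
      vecStr A.toLinearAction c π := by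
    funext h
    have h2 : ((π.rescale (fun h => (f h)⁻¹) α' hβ).toFun h).toLinearMap =
        (((f h)⁻¹ : kˣ) : k) • (π.toFun h).toLinearMap := rfl
    rw [vecStr, vecStr, h2, hf, vecMap_smul_smul, Units.inv_mul, one_smul]
  simp only [S, vecEquivObj, h1]

end S

end Equivariantization

theorem proposition3p12
    {k : Type*} [Field k] [IsAlgClosed k] [CharZero k]
    {C : Type u} [Category.{v} C] [Abelian C] [Linear k C] [MonoidalCategory C]
    [MonoidalPreadditive C] [MonoidalLinear k C] [RigidCategory C] [IsFusion k C]
    {G : Type*} [Group G] [Finite G] (A : TensorAction k G C)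
    (Y : C) [Simple Y]
    (c : ∀ h : A.inertia Y, (A.F h).obj Y ≅ Y)
    (α : A.inertia Y → A.inertia Y → kˣ) (hα : IsFactorSet A.toLinearAction c α)
    {V : Type*} [AddCommGroup V] [Module k V] [FiniteDimensional k V]
    (π : ProjRep α V) (hπ : π.Irreducible)
    (R R' : Set G) (hR : Subgroup.IsComplement R (A.inertia Y : Set G))
    (hR' : Subgroup.IsComplement R' (A.inertia Y : Set G)) :
    Simple Yᘁ ∧ A.inertia Yᘁ = A.inertia Y ∧ π.dual.Irreducible ∧
      (∃ hα' : IsFactorSet A.toLinearAction (dualFamily A c) (fun g h => (α g h)⁻¹),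
        Nonempty (ExactPairing (S A c hα π hR) (S A (dualFamily A c) hα' π.dual hR'))) ∧
      (∀ (c' : ∀ h : A.inertia Y, (A.F h).obj Yᘁ ≅ Yᘁ) (α' : A.inertia Y → A.inertia Y → kˣ)
        (hα' : IsFactorSet A.toLinearAction c' α'),
        ∃ σ : ProjRep α' (Module.Dual k V), σ.ProjEquiv π.dual ∧
          Nonempty (ExactPairing (S A c hα π hR) (S A c' hα' σ hR'))) := by
  have := IsFusion.finiteDimensional_hom (k := k) (C := C)
  have hs : Simple (Yᘁ : C) := simple_rightDual Y
  have hd := isFactorSet_dualFamily hα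
  have hS := nonempty_exactPairing_S A (dualFamily_pairing A c) hα hd π hR hR'
  refine ⟨hs, inertia_rightDual A Y, hπ.dual, ⟨hd, hS⟩, fun c' α' hα' => ?_⟩
  -- Schur's lemma for the simple object `Yᘁ`: c'^h = f(h) (c^*)^h. This dictates σ = f⁻¹ π^*,
  -- projectively equivalent to π^* through the identity of V^*.
  choose f hf using fun h => exists_unit_smul_iso (k := k) (dualFamily A c h) (c' h)
  have hβ := hd.mul_eq_of_smul hα' hf
  refine ⟨π.dual.rescale (fun h => (f h)⁻¹) α' hβ,
    ⟨LinearEquiv.refl k _, fun h => (f h)⁻¹, fun g v => rfl⟩, ?_⟩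
  rwa [S_rescale A hd hα' π.dual hf hβ hR']
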